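/- Let $\mathfrak g=\mathfrak{sl}(n,\mathbb C)$ with $n\ge 2$, let $E_{i,j}$ be the matrix units, $\mathfrak h$ the diagonal, $\mathfrak n$ the strictly upper triangular and $\mathfrak b=\mathfrak h\oplus\mathfrak n$ the upper triangular matrices in $\mathfrak g$. Let $e_i\in\mathfrak h^*$ be the $i$-th diagonal entry, $\rho=\frac12\sum_{i<j}(e_i-e_j)$, and $\langle\cdot,\cdot\rangle$ the bilinear form on $\mathfrak h^*$ dual to the trace form, so that $\langle\mu,e_i-e_j\rangle=\mu(E_{i,i}-E_{j,j})$. For $\lambda\in\mathfrak h^*$ let $M(\lambda)=U(\mathfrak g)\otimes_{U(\mathfrak b)}\mathbb C_\lambda$ be the Verma module with highest weight vector $v_\lambda$, and let $s_\alpha\cdot\lambda=s_\alpha(\lambda+\rho)-\rho$ for a root $\alpha$. A singular vector of $M(\lambda)$ is a nonzero weight vector $v$ with $\mathfrak n v=0$. Let $\Gamma$ be the set of families $a=(a_{i,j})_{1\le j<i\le n}$ of nonnegative integers, and for $a\in\Gamma$ put $$E^a=E_{2,1}^{a_{2,1}}E_{3,1}^{a_{3,1}}E_{3,2}^{a_{3,2}}E_{4,1}^{a_{4,1}}\cdots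 E_{n,1}^{a_{n,1}}\cdots E_{n,n-1}^{a_{n,n-1}}\in U(\mathfrak g).$$ **Theorem.** Let $1\le k<l\le n$ and $\lambda\in\mathfrak h^*$, and suppose that $\langle\lambda+\rho,e_k-e_l\rangle=m$ is a nonnegative integer. Put $$\Gamma_{k,l}^m=\{a\in\Gamma\mid [H,E^a]=m\,(e_l-e_k)(H)\,E^a\text{ for all }H\in\mathfrak h\},$$ and, for $a\in\Gamma$ and $k\le i\le l-1$, $$r_i=\sum_{j<i+1<q}a_{q,j},\qquad u_i=\sum_{j=k}^{i}\langle\lambda+\rho,e_j-e_{j+1}\rangle .$$ Write $\langle\gamma\rangle_r=\gamma(\gamma-1)\cdots(\gamma-r+1)$, with $\langle\gamma\rangle_0=1$. Then $\Gamma_{k,l}^m$ is finite, and $$v=\sum_{a\in\Gamma_{k,l}^m}\frac{\prod_{i=k}^{l-1}\langle u_i\rangle_{r_i}\,(m-r_i)!}{\prod_{i>j}a_{i,j}!}\,E^av_\lambda$$ is a singular vector in $M(\lambda)$ of weight $s_{e_k-e_l}\cdot\lambda$. -/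

import Mathlib

open scoped Nat TensorProduct

-- The commutator bracket on an associative algebra (matrices, enveloping algebras, `ℂ`).
attribute [local instance 100] LieRing.ofAssociativeRing

noncomputable section

namespace SlVerma

/-! Throughout, the Lie algebra is `sl(n + 1, ℂ)`, with rows and columns indexed by
`0, 1, …, n : Fin (n + 1)`; the simple roots are `e_i - e_{i+1}` with `i : Fin n`, where `i` and
`i + 1` are written `i.castSucc` and `i.succ` as elements of `Fin (n + 1)`. -/

/-- The Lie algebra `𝔤 = sl(n + 1, ℂ)`. -/
abbrev G (n : ℕ) : LieSubalgebra ℂ (Matrix (Fin (n + 1)) (Fin (n + 1)) ℂ) :=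
  LieAlgebra.SpecialLinear.sl (Fin (n + 1)) ℂ

variable {n : ℕ}

/-- The entry `(i, j)` of the commutator of two elements of `𝔤`. -/
theorem lie_entry (x y : G n) (i j : Fin (n + 1)) :
    (⁅x, y⁆ : G n).1 i j = ∑ p, x.1 i p * y.1 p j - ∑ p, y.1 i p * x.1 p j := by
  rw [LieAlgebra.SpecialLinear.sl_bracket, Matrix.sub_apply, Matrix.mul_apply, Matrix.mul_apply]

/-- The Cartan subalgebra `𝔥` of diagonal matrices in `𝔤`. -/
def cartan (n : ℕ) : LieSubalgebra ℂ (G n) where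
  carrier := {x | ∀ i j, i ≠ j → x.1 i j = 0}
  add_mem' := fun {x y} hx hy i j h => by
    change x.1 i j + y.1 i j = 0
    rw [hx i j h, hy i j h, add_zero]
  zero_mem' := fun _ _ _ => rfl
  smul_mem' := fun c x hx i j h => by
    change c * x.1 i j = 0
    rw [hx i j h, mul_zero]
  lie_mem' := fun {x y} hx hy i j h => by
    rw [lie_entry, Finset.sum_eq_zero, Finset.sum_eq_zero, sub_zero]
    · intro p _
      by_cases hp : i = p
      · subst hp; rw [hx i j h, mul_zero]
      · rw [hy i p hp, zero_mul]
    · intro p _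
      by_cases hp : i = p
      · subst hp; rw [hy i j h, mul_zero]
      · rw [hx i p hp, zero_mul]

/-- The Borel subalgebra `𝔟 = 𝔥 ⊕ 𝔫` of upper triangular matrices in `𝔤`. -/
def borel (n : ℕ) : LieSubalgebra ℂ (G n) where
  carrier := {x | ∀ i j, j < i → x.1 i j = 0}
  add_mem' := fun {x y} hx hy i j h => by
    change x.1 i j + y.1 i j = 0
    rw [hx i j h, hy i j h, add_zero]
  zero_mem' := fun _ _ _ => rfl
  smul_mem' := fun c x hx i j h => by
    change c * x.1 i j = 0
    rw [hx i j h, mul_zero]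
  lie_mem' := fun {x y} hx hy i j h => by
    rw [lie_entry, Finset.sum_eq_zero, Finset.sum_eq_zero, sub_zero]
    · intro p _
      rcases lt_or_ge p i with hp | hp
      · rw [hy i p hp, zero_mul]
      · rw [hx p j (h.trans_le hp), mul_zero]
    · intro p _
      rcases lt_or_ge p i with hp | hp
      · rw [hx i p hp, zero_mul]
      · rw [hy p j (h.trans_le hp), mul_zero]

/-- The subalgebra `𝔫` of strictly upper triangular matrices in `𝔤`, the sum of the root spaces of
the positive roots. -/
def nilradical (n : ℕ) : LieSubalgebra ℂ (G n) where
  carrier := {x | ∀ i j, j ≤ i → x.1 i j = 0}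
  add_mem' := fun {x y} hx hy i j h => by
    change x.1 i j + y.1 i j = 0
    rw [hx i j h, hy i j h, add_zero]
  zero_mem' := fun _ _ _ => rfl
  smul_mem' := fun c x hx i j h => by
    change c * x.1 i j = 0
    rw [hx i j h, mul_zero]
  lie_mem' := fun {x y} hx hy i j h => by
    rw [lie_entry, Finset.sum_eq_zero, Finset.sum_eq_zero, sub_zero]
    · intro p _
      rcases le_or_gt p i with hp | hp
      · rw [hy i p hp, zero_mul]
      · rw [hx p j (h.trans hp.le), mul_zero]
    · intro p _
      rcases le_or_gt p i with hp | hp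
      · rw [hx i p hp, zero_mul]
      · rw [hy p j (h.trans hp.le), mul_zero]

/-- The dual space `𝔥*`. -/
abbrev Weight (n : ℕ) : Type := Module.Dual ℂ (cartan n)

/-- The diagonal matrix with diagonal `d`, for `d` of sum zero, as an element of `𝔥`. -/
def diagElt (d : Fin (n + 1) → ℂ) (hd : ∑ i, d i = 0) : cartan n :=
  ⟨⟨Matrix.diagonal d, by
    change Matrix.trace (Matrix.diagonal d) = 0
    rw [Matrix.trace_diagonal, hd]⟩, fun _ _ h => Matrix.diagonal_apply_ne _ h⟩

theorem diagElt_apply (d : Fin (n + 1) → ℂ) (hd : ∑ i, d i = 0) (i : Fin (n + 1)) :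
    (diagElt d hd).1.1 i i = d i := Matrix.diagonal_apply_eq d i

theorem sum_diag (x : G n) : ∑ i, x.1 i i = 0 := x.2

/-- The function `e_i` on `𝔥`: the `i`-th diagonal entry. -/
def e (i : Fin (n + 1)) : Weight n where
  toFun H := H.1.1 i i
  map_add' _ _ := rfl
  map_smul' _ _ := rfl

/-- The diagonal matrix `E_{i,i} - (n + 1)⁻¹ • 1` in `𝔥`. -/
def eps (i : Fin (n + 1)) : cartan n :=
  diagElt (fun j => (if j = i then 1 else 0) - ((n : ℂ) + 1)⁻¹) (by
    have h : (n : ℂ) + 1 ≠ 0 := Nat.cast_add_one_ne_zero n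
    simp [Finset.sum_sub_distrib, h])

/-- The usual bilinear form on `𝔥*`, dual to the trace form on `𝔥`; it satisfies
`⟨e_i - e_j, e_i - e_j⟩ = 2` for `i ≠ j`. -/
def form (μ ν : Weight n) : ℂ := ∑ i, μ (eps i) * ν (eps i)

/-- `ρ`, half the sum of the positive roots `e_i - e_j`, `i < j`. -/
def rho (n : ℕ) : Weight n :=
  (1 / 2 : ℂ) • ∑ p : Fin (n + 1) × Fin (n + 1) with p.1 < p.2, (e p.1 - e p.2)

/-- The coroot `β^∨ = 2 β / ⟨β, β⟩`. -/
def check (β : Weight n) : Weight n := (2 / form β β) • β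

/-- The reflection `s_β` on `𝔥*`. -/
def reflect (β μ : Weight n) : Weight n := μ - form μ (check β) • β

/-- The dot action of the reflection `s_β`: `s_β · lam = s_β (lam + ρ) - ρ`. -/
def dotReflect (β lam : Weight n) : Weight n := reflect β (lam + rho n) - rho n

/-- Two elements of `𝔥` with the same diagonal are equal. -/
theorem cartan_ext {x y : cartan n} (h : ∀ i, x.1.1 i i = y.1.1 i i) : x = y := by
  apply Subtype.ext
  apply Subtype.ext
  funext i j
  by_cases hij : i = j
  · subst hij; exact h i
  · rw [x.2 i j hij, y.2 i j hij]

/-- The projection `𝔟 = 𝔥 ⊕ 𝔫 → 𝔥`, which takes the diagonal part. -/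
def diagPart (n : ℕ) : borel n →ₗ[ℂ] cartan n where
  toFun x := diagElt (fun i => x.1.1 i i) (sum_diag x.1)
  map_add' x y := cartan_ext fun i =>
    (diagElt_apply _ _ i).trans (congrArg₂ (· + ·) (diagElt_apply _ (sum_diag x.1) i).symm
      (diagElt_apply _ (sum_diag y.1) i).symm)
  map_smul' c x := cartan_ext fun i =>
    (diagElt_apply _ _ i).trans (congrArg (c * ·) (diagElt_apply _ (sum_diag x.1) i).symm)

/-- The diagonal part of a commutator of upper triangular matrices vanishes. -/
theorem diagPart_lie (x y : borel n) : diagPart n ⁅x, y⁆ = 0 := cartan_ext fun i => by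
  refine (diagElt_apply _ (sum_diag (⁅x, y⁆ : borel n).1) i).trans ?_
  change (⁅x, y⁆ : borel n).1.1 i i = 0
  rw [LieSubalgebra.coe_bracket, lie_entry, ← Finset.sum_sub_distrib]
  refine Finset.sum_eq_zero fun p _ => ?_
  rcases lt_trichotomy p i with hp | hp | hp
  · rw [x.2 i p hp, y.2 i p hp]; ring
  · subst hp; ring
  · rw [x.2 p i hp, y.2 p i hp]; ring

/-- The one-dimensional representation of `𝔟` of weight `lam`: `𝔥` acts through `lam` and `𝔫` acts
by zero, so that `x ∈ 𝔟` acts by the value of `lam` on the diagonal part of `x`. -/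
def borelChar (lam : Weight n) : borel n →ₗ⁅ℂ⁆ ℂ where
  toLinearMap := lam ∘ₗ diagPart n
  map_lie' := fun {x y} => by
    change lam (diagPart n ⁅x, y⁆) = _
    rw [diagPart_lie, map_zero, LieRing.of_associative_ring_bracket, mul_comm, sub_self]

/-- The universal enveloping algebra `U(𝔤)`. -/
abbrev U (n : ℕ) : Type := UniversalEnvelopingAlgebra ℂ (G n)

/-- The universal enveloping algebra `U(𝔟)`. -/
abbrev UB (n : ℕ) : Type := UniversalEnvelopingAlgebra ℂ (borel n)

/-- The canonical map `𝔤 → U(𝔤)`. -/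
abbrev toU (x : G n) : U n := UniversalEnvelopingAlgebra.ι ℂ x

/-- The algebra map `U(𝔟) → U(𝔤)` induced by the inclusion `𝔟 ⊆ 𝔤`. -/
def inclU (n : ℕ) : UB n →ₐ[ℂ] U n :=
  UniversalEnvelopingAlgebra.lift ℂ ((UniversalEnvelopingAlgebra.ι ℂ).comp (borel n).incl)

/-- The action of `U(𝔟)` on the one-dimensional `𝔟`-module of weight `lam`. -/
def charU (lam : Weight n) : UB n →ₐ[ℂ] ℂ :=
  UniversalEnvelopingAlgebra.lift ℂ (borelChar lam)

/-- The `U(𝔤)`-submodule of `U(𝔤) ⊗_ℂ ℂ` spanned by the relations `u b ⊗ z - u ⊗ b z` with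
`u ∈ U(𝔤)`, `b ∈ U(𝔟)`, `z` in the one-dimensional `𝔟`-module of weight `lam`. -/
def balance (lam : Weight n) : Submodule (U n) (U n ⊗[ℂ] ℂ) :=
  Submodule.span (U n) {t | ∃ (u : U n) (b : UB n) (z : ℂ),
    t = (u * inclU n b) ⊗ₜ[ℂ] z - u ⊗ₜ[ℂ] (charU lam b * z)}

/-- The Verma module `M(lam) = U(𝔤) ⊗_{U(𝔟)} ℂ_lam`, a left `U(𝔤)`-module. -/
abbrev Verma (lam : Weight n) : Type := (U n ⊗[ℂ] ℂ) ⧸ balance lam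

/-- The highest weight vector `v_lam = 1 ⊗ 1`. -/
def vac (lam : Weight n) : Verma lam := (balance lam).mkQ (1 ⊗ₜ[ℂ] 1)

/-- `v` is a (nonzero) weight vector of weight `μ`. -/
def IsWeightVector {lam : Weight n} (μ : Weight n) (v : Verma lam) : Prop :=
  v ≠ 0 ∧ ∀ H : cartan n, toU H.1 • v = μ H • v

/-- `v` is a singular vector: a weight vector with `𝔫 • v = 0`. -/
def IsSingular {lam : Weight n} (v : Verma lam) : Prop :=
  (∃ μ, IsWeightVector μ v) ∧ ∀ x ∈ nilradical n, toU x • v = 0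

/-- The index set of the pairs `(i, j)` with `j < i`. -/
abbrev NegIdx (n : ℕ) : Type := {p : Fin (n + 1) × Fin (n + 1) // p.2 < p.1}

/-- The additive semigroup `Γ` of exponents `a = (a_{i,j})_{j < i}`. -/
abbrev Expo (n : ℕ) : Type := NegIdx n → ℕ

/-- The root vector `E_{i,j}` of `𝔤`, for `j < i`. -/
def E (p : NegIdx n) : G n := LieAlgebra.SpecialLinear.single p.1.1 p.1.2 p.2.ne' 1

/-- The PBW monomial `E^a`: the ordered product, over the rows `i` in increasing order and within
each row over the columns `j < i` in increasing order, of the powers `E_{i,j} ^ a_{i,j}`. -/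
def mono (a : Expo n) : U n :=
  (List.ofFn fun i : Fin (n + 1) =>
    (List.ofFn fun j : Fin (n + 1) =>
      if h : j < i then toU (E ⟨(i, j), h⟩) ^ a ⟨(i, j), h⟩ else 1).prod).prod

/-- `Γ_{k,l}^m`: the exponents `a` with `[H, E^a] = m (e_l - e_k)(H) E^a` for all `H ∈ 𝔥`. -/
def weightExpo (k l : Fin (n + 1)) (m : ℕ) : Set (Expo n) :=
  {a | ∀ H : cartan n, ⁅toU H.1, mono a⁆ = ((m : ℂ) * (e l - e k) H) • mono a}

/-- `r_i = ∑_{j < i + 1 < q} a_{q,j}`. -/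
def r (a : Expo n) (i : Fin n) : ℕ :=
  ∑ p : NegIdx n with p.1.2 < i.succ ∧ i.succ < p.1.1, a p

/-- `lam_i = ⟨lam + ρ, e_i - e_{i+1}⟩`. -/
def simpleCoord (lam : Weight n) (i : Fin n) : ℂ :=
  form (lam + rho n) (e i.castSucc - e i.succ)

/-- `u_i = ∑_{j=k}^i lam_j`. -/
def u (lam : Weight n) (k : Fin (n + 1)) (i : Fin n) : ℂ :=
  ∑ j : Fin n with k ≤ j.castSucc ∧ j ≤ i, simpleCoord lam j

/-- The coefficient `∏_{i=k}^{l-1} ⟨u_i⟩_{r_i} (m - r_i)! / ∏_{i>j} a_{i,j}!`, where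
`⟨γ⟩_r = γ (γ - 1) ⋯ (γ - r + 1)`. For `a ∈ Γ_{k,l}^m` one has `r_i ≤ m`. -/
def coeff (lam : Weight n) (k l : Fin (n + 1)) (m : ℕ) (a : Expo n) : ℂ :=
  (∏ i : Fin n with k ≤ i.castSucc ∧ i.castSucc < l,
      (descPochhammer ℂ (r a i)).eval (u lam k i) * ((m - r a i)! : ℂ)) /
    ∏ p : NegIdx n, ((a p)! : ℂ)

end SlVerma

end

open SlVerma

/-! Read E_{i,j} as an arrow from node j to node i. An exponent a is then a flow, and a lies in
Γ_{k,l}^m exactly when it carries m units from k to l.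

Annihilation by 𝔫. The row-by-row order of E^a is chosen so that a simple root vector E_{i,i+1},
moved to the right through E^a, picks up from each factor a scalar multiple of a single ordered
monomial (`raise_smul_mono`). For a fixed b, the contributions to E^b in E_{i,i+1} v come from
arrows into i+1, from arrows out of i, and from the arrow i → i+1. The denominators ∏ a_{i,j}!
absorb the multiplicities, so these contributions collapse to three terms, governed by the row sum
of b at i and its column sums at i and i+1 (`sum_pull`). Flow conservation across the cuts next to i
and i+1 identifies the row sum at i with m - r_{i-1} and the column sum at i+1 with m - r_i. The
factor ⟨u⟩_r (m-r)! is designed for this: replacing r by r+1 multiplies it by (u-r)/(m-r)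
(`numer_bump`). The three terms then add to zero (`cancellation`); the hypothesis ⟨λ+ρ, e_k-e_l⟩ = m
enters at the boundary i+1 = l. Simple root vectors generate 𝔫, so v is killed by 𝔫.

Nonvanishing. Instead of a basis of M(λ), a Whittaker functional ψ is used: ψ(v_λ) = 1, and
ψ(E_{i,j} w) is ψ(w) for i = j+1 and 0 otherwise (`exists_whittaker`). It kills every E^a v_λ in the
sum except the one whose arrows all have length 1, and the coefficient of that one is nonzero. To
build ψ, consider functions F on the open cell N⁻TN with F(n⁻g) = χ(n⁻)F(g), where χ is the
nondegenerate character of N⁻ and 𝔤 acts by right translation. After division by t^λ they include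
the polynomials in the entries of n ∈ N and in y_j = t_{j+1}/t_j. The constant 1 is a highest weight
vector of weight λ, which gives a map from M(λ), and ψ is evaluation at the identity.

Finally, the bracket condition defining Γ_{k,l}^m pins down the weight of a only because E^a ≠ 0 in
U(𝔤); this is `mono_ne_zero`. -/

noncomputable section

namespace SlVerma

/-! ### Commutators and triangular parts of matrices -/

section Triangular

set_option linter.unusedSectionVars false

variable {N A : Type*} [Fintype N] [LinearOrder N] [CommRing A]

/-- The strictly upper triangular part of a matrix. -/
def strictUpper (M : Matrix N N A) : Matrix N N A :=
  Matrix.of fun i j => if i < j then M i j else 0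

/-- The upper triangular part of a matrix. -/
def upper (M : Matrix N N A) : Matrix N N A :=
  Matrix.of fun i j => if i ≤ j then M i j else 0

theorem strictUpper_apply (M : Matrix N N A) (i j : N) :
    strictUpper M i j = if i < j then M i j else 0 := rfl

theorem upper_apply (M : Matrix N N A) (i j : N) :
    upper M i j = if i ≤ j then M i j else 0 := rfl

theorem strictUpper_add (M M' : Matrix N N A) :
    strictUpper (M + M') = strictUpper M + strictUpper M' := by
  ext i j; simp only [strictUpper_apply, Matrix.add_apply]; split_ifs <;> simp

theorem strictUpper_mul_apply_of_le (M M' : Matrix N N A) {i j : N} (h : j ≤ i) :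
    (strictUpper M * strictUpper M') i j = 0 := by
  rw [Matrix.mul_apply]
  refine Finset.sum_eq_zero fun p _ => ?_
  simp only [strictUpper_apply]
  rcases lt_or_ge i p with hp | hp
  · rw [if_neg (not_lt.2 (h.trans hp.le) : ¬ p < j), mul_zero]
  · rw [if_neg (not_lt.2 hp), zero_mul]

theorem lower_mul_lower_apply (M M' : Matrix N N A) {i j : N} (h : i < j) :
    ((M - strictUpper M) * (M' - strictUpper M')) i j = 0 := by
  rw [Matrix.mul_apply]
  refine Finset.sum_eq_zero fun p _ => ?_
  simp only [strictUpper_apply, Matrix.sub_apply]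
  rcases lt_or_ge i p with hp | hp
  · rw [if_pos hp, sub_self, zero_mul]
  · rw [if_pos (hp.trans_lt h), sub_self, mul_zero]

theorem lower_mul_lower_diag (M M' : Matrix N N A) (i : N) :
    ((M - strictUpper M) * (M' - strictUpper M')) i i = M i i * M' i i := by
  rw [Matrix.mul_apply, Finset.sum_eq_single i]
  · simp [strictUpper_apply]
  · intro p _ hp
    simp only [strictUpper_apply, Matrix.sub_apply]
    rcases lt_or_gt_of_ne hp with h | h
    · rw [if_pos h, sub_self, mul_zero]
    · rw [if_pos h, sub_self, zero_mul]
  · simp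

theorem upper_mul_upper_apply (M M' : Matrix N N A) {i j : N} (h : j < i) :
    (upper M * upper M') i j = 0 := by
  rw [Matrix.mul_apply]
  refine Finset.sum_eq_zero fun p _ => ?_
  simp only [upper_apply]
  rcases lt_or_ge p i with hp | hp
  · rw [if_neg (not_le.2 hp), zero_mul]
  · rw [if_neg (not_le.2 (h.trans_le hp) : ¬ p ≤ j), mul_zero]

theorem strictLower_mul_apply (M M' : Matrix N N A) {i j : N} (h : j ⋖ i) :
    ((M - upper M) * (M' - upper M')) i j = 0 := by
  rw [Matrix.mul_apply]
  refine Finset.sum_eq_zero fun p _ => ?_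
  simp only [upper_apply, Matrix.sub_apply]
  rcases le_or_gt i p with hp | hp
  · rw [if_pos hp, sub_self, zero_mul]
  · rw [if_pos (not_lt.1 fun hj => h.2 hj hp : p ≤ j), sub_self, mul_zero]

/-- The commutator of matrices. -/
def comm (M M' : Matrix N N A) : Matrix N N A := M * M' - M' * M

/-- Bilinear expansion. With P, P' triangular parts of M, M', the last bracket lives in the
complementary triangular subalgebra and drops out of the entries of interest. -/
theorem comm_decomp (M M' P P' : Matrix N N A) :
    comm M M' = comm P M' + comm M P' - (P * P' - P' * P) +
      ((M - P) * (M' - P') - (M' - P') * (M - P)) := by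
  simp only [comm]; noncomm_ring

/-- Both the strictly upper and the lower triangular matrices are closed under brackets, so the
bracket of the lower parts has no strictly upper part. This is why the vector fields `wDer` respect
brackets. -/
theorem strictUpper_comm (M M' : Matrix N N A) :
    strictUpper (comm M M') = strictUpper (comm (strictUpper M) M') +
      strictUpper (comm M (strictUpper M')) - comm (strictUpper M) (strictUpper M') := by
  ext i j
  simp only [Matrix.add_apply, Matrix.sub_apply, strictUpper_apply _ i j]
  split_ifs with h
  · have := congr_fun (congr_fun (comm_decomp M M' (strictUpper M) (strictUpper M')) i) j
    rw [this]
    simp only [Matrix.add_apply, Matrix.sub_apply _ _ i j, lower_mul_lower_apply _ _ h]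
    simp [comm]
  · have h := not_lt.1 h
    simp [comm, strictUpper_mul_apply_of_le _ _ h]

theorem comm_apply_diag (M M' : Matrix N N A) (i : N) :
    comm M M' i i = comm (strictUpper M) M' i i + comm M (strictUpper M') i i := by
  have := congr_fun (congr_fun (comm_decomp M M' (strictUpper M) (strictUpper M')) i) i
  rw [this]
  simp only [Matrix.add_apply, Matrix.sub_apply _ _ i i, lower_mul_lower_diag,
    strictUpper_mul_apply_of_le _ _ le_rfl]
  ring

/-- A product of two strictly lower triangular matrices starts two steps below the diagonal: this is
the additivity of the character χ. -/
theorem comm_apply_covBy (M M' : Matrix N N A) {i j : N} (h : j ⋖ i) :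
    comm M M' i j = comm (upper M) M' i j + comm M (upper M') i j := by
  have := congr_fun (congr_fun (comm_decomp M M' (upper M) (upper M')) i) j
  rw [this]
  simp only [Matrix.add_apply, Matrix.sub_apply _ _ i j, upper_mul_upper_apply _ _ h.1,
    strictLower_mul_apply _ _ h]
  ring

theorem upper_eq (M : Matrix N N A) :
    upper M = strictUpper M + Matrix.diagonal fun i => M i i := by
  ext i j
  simp only [Matrix.add_apply, upper_apply, strictUpper_apply, Matrix.diagonal_apply]
  rcases lt_trichotomy i j with h | h | h
  · simp [h, h.le, h.ne]
  · simp [h]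
  · simp [h.not_ge, h.not_gt, h.ne']

theorem comm_upper_apply (M M' : Matrix N N A) (i j : N) :
    comm (upper M) M' i j = comm (strictUpper M) M' i j + (M i i - M j j) * M' i j := by
  rw [upper_eq]
  simp only [comm, add_mul, mul_add, Matrix.sub_apply, Matrix.add_apply, Matrix.diagonal_mul,
    Matrix.mul_diagonal]
  ring

theorem comm_antisymm (M M' : Matrix N N A) : comm M M' = - comm M' M := by
  simp [comm]

end Triangular

theorem map_derivation_mul {N A : Type*} [Fintype N] [CommRing A] [Algebra ℂ A]
    (D : Derivation ℂ A A) (M M' : Matrix N N A) :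
    (M * M').map D = M.map D * M' + M * M'.map D := by
  ext i j
  simp only [Matrix.map_apply, Matrix.mul_apply, Matrix.add_apply, map_sum, Derivation.leibniz,
    smul_eq_mul, ← Finset.sum_add_distrib]
  refine Finset.sum_congr rfl fun p _ => ?_
  ring

/-- Differentiating M M' = 1 shows that D acts on M' as right multiplication by -S. -/
theorem map_derivation_conj {N A : Type*} [Fintype N] [LinearOrder N] [CommRing A] [Algebra ℂ A]
    (D : Derivation ℂ A A) {M M' S Y : Matrix N N A} (h : M * M' = 1) (hM : M.map D = S * M)
    (hY : Y.map D = 0) : (M * Y * M').map D = comm S (M * Y * M') := by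
  have h' : M' * M = 1 := mul_eq_one_comm.1 h
  have hinv : M'.map D = - (M' * S) := by
    have h0 : (1 : Matrix N N A).map D = 0 := by
      ext1 i j
      rw [Matrix.map_apply, Matrix.one_apply]
      split_ifs <;> simp
    have h1 := map_derivation_mul D M M'
    rw [h, hM, h0, Matrix.mul_assoc, h, Matrix.mul_one] at h1
    calc M'.map D = M' * M * M'.map D := by rw [h', Matrix.one_mul]
      _ = _ := by
        rw [Matrix.mul_assoc, (neg_eq_of_add_eq_zero_right h1.symm).symm, Matrix.mul_neg]
  rw [map_derivation_mul, map_derivation_mul, hM, hY, hinv, comm]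
  noncomm_ring

/-! ### Vector fields on the open cell N⁻TN modulo N⁻, and their cocycle -/

section Whittaker

variable (n : ℕ)

/-- The coordinate ring of the quotient of the upper triangular group that carries the Whittaker
functional: the entries of a unipotent matrix, and one torus coordinate for every simple root. -/
abbrev WRing : Type := MvPolynomial ((Fin (n + 1) × Fin (n + 1)) ⊕ Fin n) ℂ

/-- The generic unipotent upper triangular matrix. -/
def unip : Matrix (Fin (n + 1)) (Fin (n + 1)) (WRing n) :=
  Matrix.of fun i j => if i < j then MvPolynomial.X (Sum.inl (i, j)) else if i = j then 1 else 0

theorem unip_blockTriangular : (unip n).BlockTriangular id := fun i j h => by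
  have h : j < i := h
  simp [unip, h.not_gt, h.ne']

theorem isUnit_det_unip : IsUnit (unip n).det := by
  rw [Matrix.det_of_isUpperTriangular (unip_blockTriangular n)]
  simp [unip]

variable {n}

/-- The conjugate of a constant matrix by the generic unipotent matrix. -/
def conj (X : Matrix (Fin (n + 1)) (Fin (n + 1)) ℂ) :
    Matrix (Fin (n + 1)) (Fin (n + 1)) (WRing n) :=
  unip n * X.map MvPolynomial.C * (unip n)⁻¹

theorem conj_add (X Y : Matrix (Fin (n + 1)) (Fin (n + 1)) ℂ) :
    conj (X + Y) = conj X + conj Y := by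
  simp only [conj]
  rw [Matrix.map_add _ (map_add _), mul_add, add_mul]

theorem conj_smul (c : ℂ) (X : Matrix (Fin (n + 1)) (Fin (n + 1)) ℂ) :
    conj (c • X) = c • conj X := by
  simp only [conj]
  rw [Matrix.map_smul (R := ℂ) _ c (fun x => by
    rw [smul_eq_mul, map_mul, MvPolynomial.smul_eq_C_mul]),
    Matrix.mul_smul, Matrix.smul_mul]

theorem conj_comm (X Y : Matrix (Fin (n + 1)) (Fin (n + 1)) ℂ) :
    conj (comm X Y) = comm (conj X) (conj Y) := by
  have h : (unip n)⁻¹ * unip n = 1 := Matrix.nonsing_inv_mul _ (isUnit_det_unip n)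
  have key : ∀ X Y : Matrix (Fin (n + 1)) (Fin (n + 1)) ℂ, conj X * conj Y = conj (X * Y) := by
    intro X Y
    simp only [conj]
    rw [Matrix.map_mul]
    calc _ = unip n * X.map MvPolynomial.C * ((unip n)⁻¹ * unip n) * Y.map MvPolynomial.C *
        (unip n)⁻¹ := by noncomm_ring
      _ = _ := by rw [h]; noncomm_ring
  simp only [comm, key]
  rw [sub_eq_add_neg, conj_add, ← neg_one_smul ℂ (Y * X), conj_smul, neg_one_smul, sub_eq_add_neg]

/-- The infinitesimal action of `𝔤𝔩` on `WRing n`. -/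
def wDer (X : Matrix (Fin (n + 1)) (Fin (n + 1)) ℂ) : Derivation ℂ (WRing n) (WRing n) :=
  MvPolynomial.mkDerivation ℂ (Sum.elim
    (fun p => (strictUpper (conj X) * unip n) p.1 p.2)
    (fun j => (conj X j.succ j.succ - conj X j.castSucc j.castSucc) *
      MvPolynomial.X (Sum.inr j)))

theorem strictUpper_mul_unip_apply (M : Matrix (Fin (n + 1)) (Fin (n + 1)) (WRing n))
    {i j : Fin (n + 1)} (h : j ≤ i) : (strictUpper M * unip n) i j = 0 := by
  rw [Matrix.mul_apply]
  refine Finset.sum_eq_zero fun p _ => ?_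
  rw [strictUpper_apply]
  split_ifs with hp
  · rw [unip_blockTriangular n (show id j < id p from h.trans_lt hp), mul_zero]
  · rw [zero_mul]

theorem wDer_inl (X : Matrix (Fin (n + 1)) (Fin (n + 1)) ℂ) (i j : Fin (n + 1)) :
    wDer X (MvPolynomial.X (Sum.inl (i, j))) = (strictUpper (conj X) * unip n) i j := by
  simp [wDer, MvPolynomial.mkDerivation_X]

theorem wDer_inr (X : Matrix (Fin (n + 1)) (Fin (n + 1)) ℂ) (j : Fin n) :
    wDer X (MvPolynomial.X (Sum.inr j)) =
      (conj X j.succ j.succ - conj X j.castSucc j.castSucc) * MvPolynomial.X (Sum.inr j) := by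
  simp [wDer, MvPolynomial.mkDerivation_X]

theorem map_wDer_unip (X : Matrix (Fin (n + 1)) (Fin (n + 1)) ℂ) :
    (unip n).map (wDer X) = strictUpper (conj X) * unip n := by
  ext1 i j
  rw [Matrix.map_apply]
  by_cases h : i < j
  · rw [← wDer_inl]; simp [unip, h]
  · rw [strictUpper_mul_unip_apply _ (not_lt.1 h)]
    simp only [unip, Matrix.of_apply, if_neg h]
    split_ifs <;> simp

theorem map_wDer_conj (X Y : Matrix (Fin (n + 1)) (Fin (n + 1)) ℂ) :
    (conj Y).map (wDer X) = comm (strictUpper (conj X)) (conj Y) := by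
  refine map_derivation_conj (wDer X) (Matrix.mul_nonsing_inv _ (isUnit_det_unip n))
    (map_wDer_unip X) ?_
  ext1 i j
  exact MvPolynomial.derivation_C (wDer X) (Y i j)

theorem wDer_conj_apply (X Y : Matrix (Fin (n + 1)) (Fin (n + 1)) ℂ) (i j : Fin (n + 1)) :
    wDer X (conj Y i j) = comm (strictUpper (conj X)) (conj Y) i j :=
  congr_fun (congr_fun (map_wDer_conj X Y) i) j

theorem map_wDer_strictUpper (X Y : Matrix (Fin (n + 1)) (Fin (n + 1)) ℂ) :
    (strictUpper (conj Y)).map (wDer X) =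
      strictUpper (comm (strictUpper (conj X)) (conj Y)) := by
  ext1 i j
  rw [Matrix.map_apply, strictUpper_apply, strictUpper_apply, ← wDer_conj_apply]
  split_ifs <;> simp

/-- `wDer X` is right translation by X: g(1+εX) = (1+ε gXg⁻¹)g, where the strictly upper part of
gXg⁻¹ moves the unipotent coordinates and its diagonal moves the torus. On the generators the
identity reduces to `strictUpper_comm` and `comm_apply_diag`. -/
theorem wDer_comm (X Y : Matrix (Fin (n + 1)) (Fin (n + 1)) ℂ) (f : WRing n) :
    wDer (comm X Y) f = wDer X (wDer Y f) - wDer Y (wDer X f) := by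
  have key : wDer (comm X Y) = ⁅wDer X, wDer Y⁆ := by
    refine MvPolynomial.derivation_ext fun s => ?_
    rw [Derivation.commutator_apply]
    rcases s with ⟨i, j⟩ | j
    · have h1 : ∀ X Y : Matrix (Fin (n + 1)) (Fin (n + 1)) ℂ,
          wDer X (wDer Y (MvPolynomial.X (Sum.inl (i, j)))) =
          (strictUpper (comm (strictUpper (conj X)) (conj Y)) * unip n +
            strictUpper (conj Y) * (strictUpper (conj X) * unip n)) i j := by
        intro X Y
        have h := map_derivation_mul (wDer X) (strictUpper (conj Y)) (unip n)
        rw [map_wDer_strictUpper, map_wDer_unip] at h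
        rw [wDer_inl, ← h, Matrix.map_apply]
      have h2 : strictUpper (comm (conj X) (strictUpper (conj Y))) =
          - strictUpper (comm (strictUpper (conj Y)) (conj X)) := by
        rw [comm_antisymm]
        ext i j
        simp only [strictUpper_apply, Matrix.neg_apply]
        split_ifs <;> simp
      have h3 : strictUpper (conj (comm X Y)) * unip n =
          (strictUpper (comm (strictUpper (conj X)) (conj Y)) * unip n +
            strictUpper (conj Y) * (strictUpper (conj X) * unip n)) -
          (strictUpper (comm (strictUpper (conj Y)) (conj X)) * unip n +
            strictUpper (conj X) * (strictUpper (conj Y) * unip n)) := by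
        rw [conj_comm, strictUpper_comm, h2]
        generalize strictUpper (comm (strictUpper (conj X)) (conj Y)) = P
        generalize strictUpper (comm (strictUpper (conj Y)) (conj X)) = Q
        simp only [comm]
        noncomm_ring
      rw [h1, h1, wDer_inl, h3, Matrix.sub_apply]
    · have h2 := comm_apply_diag (conj X) (conj Y)
      have h3 : ∀ i, comm (conj X) (strictUpper (conj Y)) i i =
          - comm (strictUpper (conj Y)) (conj X) i i := fun i => by
        rw [comm_antisymm, Matrix.neg_apply]
      simp only [wDer_inr, conj_comm, Derivation.leibniz, map_sub, wDer_conj_apply, smul_eq_mul,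
        h2, h3]
      ring
  rw [key, Derivation.commutator_apply]

/-- The twist of the infinitesimal action, for the diagonal character `c`. -/
def twist (c : Fin (n + 1) → ℂ) (X : Matrix (Fin (n + 1)) (Fin (n + 1)) ℂ) : WRing n :=
  ∑ j : Fin n, MvPolynomial.X (Sum.inr j) * conj X j.succ j.castSucc +
    ∑ i, MvPolynomial.C (c i) * conj X i i

/-- Differentiating the torus coordinate supplies the diagonal contribution that turns `strictUpper`
into `upper` in the first sum. -/
theorem wDer_twist (c : Fin (n + 1) → ℂ) (X Y : Matrix (Fin (n + 1)) (Fin (n + 1)) ℂ) :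
    wDer X (twist c Y) =
      ∑ j : Fin n, MvPolynomial.X (Sum.inr j) * comm (upper (conj X)) (conj Y) j.succ j.castSucc +
      ∑ i, MvPolynomial.C (c i) * comm (strictUpper (conj X)) (conj Y) i i := by
  simp only [twist, map_add, map_sum, Derivation.leibniz, wDer_inr, wDer_conj_apply,
    comm_upper_apply, smul_eq_mul]
  congr 1
  · refine Finset.sum_congr rfl fun j _ => ?_
    ring
  · refine Finset.sum_congr rfl fun j _ => ?_
    rw [show wDer X (MvPolynomial.C (c j)) = 0 from MvPolynomial.derivation_C _ _]
    ring

/-- The cocycle condition that lets `wDer` plus multiplication by `twist` be a representation. -/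
theorem twist_comm (c : Fin (n + 1) → ℂ) (X Y : Matrix (Fin (n + 1)) (Fin (n + 1)) ℂ) :
    twist c (comm X Y) = wDer X (twist c Y) - wDer Y (twist c X) := by
  rw [wDer_twist, wDer_twist, twist, conj_comm, add_sub_add_comm, ← Finset.sum_sub_distrib,
    ← Finset.sum_sub_distrib]
  congr 1
  · refine Finset.sum_congr rfl fun j _ => ?_
    rw [comm_apply_covBy _ _ (show j.castSucc ⋖ j.succ from Fin.covBy_iff.2 (by simp)),
      comm_antisymm (conj X) (upper _), Matrix.neg_apply]
    ring
  · refine Finset.sum_congr rfl fun j _ => ?_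
    rw [comm_apply_diag, comm_antisymm (conj X) (strictUpper _), Matrix.neg_apply]
    ring

end Whittaker

theorem eps_apply {n : ℕ} (i j : Fin (n + 1)) :
    (eps i).1.1 j j = (if j = i then 1 else 0) - ((n : ℂ) + 1)⁻¹ := diagElt_apply _ _ _

/-- The corrections by (n+1)⁻¹ cancel because H has trace zero. -/
theorem eq_sum_eps {n : ℕ} (H : cartan n) : H = ∑ i, H.1.1 i i • eps i := by
  have hadd : ∀ j, e j (∑ i, H.1.1 i i • eps i) = H.1.1 j j := fun j => by
    simp only [map_sum, map_smul, smul_eq_mul]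
    change ∑ i, H.1.1 i i * (eps i).1.1 j j = _
    simp only [eps_apply, mul_sub, Finset.sum_sub_distrib, ← Finset.sum_mul, sum_diag]
    simp
  exact cartan_ext fun j => (hadd j).symm

theorem weight_apply {n : ℕ} (μ : Weight n) (H : cartan n) :
    μ H = ∑ i, H.1.1 i i * μ (eps i) := by
  conv_lhs => rw [eq_sum_eps H]
  simp only [map_sum, map_smul, smul_eq_mul]

/-! ### The twisted representation and the Whittaker functional -/

section Whittaker

variable {n : ℕ}

theorem wDer_add (X Y : Matrix (Fin (n + 1)) (Fin (n + 1)) ℂ) :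
    wDer (X + Y) = wDer X + wDer Y := by
  refine MvPolynomial.derivation_ext fun s => ?_
  rcases s with ⟨i, j⟩ | j
  · simp only [Derivation.add_apply, wDer_inl, conj_add, strictUpper_add, add_mul,
      Matrix.add_apply]
  · simp only [Derivation.add_apply, wDer_inr, conj_add, Matrix.add_apply]
    ring

theorem wDer_smul (c : ℂ) (X : Matrix (Fin (n + 1)) (Fin (n + 1)) ℂ) :
    wDer (c • X) = c • wDer X := by
  have h : strictUpper (c • conj X) = c • strictUpper (conj X) := by
    ext1 i j
    simp only [strictUpper_apply, Matrix.smul_apply]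
    split_ifs <;> simp
  refine MvPolynomial.derivation_ext fun s => ?_
  rcases s with ⟨i, j⟩ | j
  · simp only [Derivation.smul_apply, wDer_inl, conj_smul, h, Matrix.smul_mul, Matrix.smul_apply]
  · simp only [Derivation.smul_apply, wDer_inr, conj_smul, Matrix.smul_apply, ← smul_sub,
      smul_mul_assoc]

theorem twist_add (c : Fin (n + 1) → ℂ) (X Y : Matrix (Fin (n + 1)) (Fin (n + 1)) ℂ) :
    twist c (X + Y) = twist c X + twist c Y := by
  simp only [twist, conj_add, Matrix.add_apply, mul_add, Finset.sum_add_distrib]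
  ring

theorem twist_smul (c : Fin (n + 1) → ℂ) (z : ℂ) (X : Matrix (Fin (n + 1)) (Fin (n + 1)) ℂ) :
    twist c (z • X) = z • twist c X := by
  simp only [twist, conj_smul, Matrix.smul_apply, mul_smul_comm, Finset.smul_sum, smul_add]

/-- The twisted action of `𝔤` on `WRing n`. -/
def wRep (c : Fin (n + 1) → ℂ) : G n →ₗ⁅ℂ⁆ Module.End ℂ (WRing n) where
  toFun X := (wDer X.1).toLinearMap + LinearMap.mulLeft ℂ (twist c X.1)
  map_add' X Y := by
    refine LinearMap.ext fun f => ?_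
    change wDer (X.1 + Y.1) f + twist c (X.1 + Y.1) * f =
      (wDer X.1 f + twist c X.1 * f) + (wDer Y.1 f + twist c Y.1 * f)
    rw [wDer_add, twist_add, Derivation.add_apply]
    ring
  map_smul' z X := by
    refine LinearMap.ext fun f => ?_
    change wDer (z • X.1) f + twist c (z • X.1) * f = z • (wDer X.1 f + twist c X.1 * f)
    rw [wDer_smul, twist_smul, Derivation.smul_apply, smul_add, smul_mul_assoc]
  map_lie' {X Y} := by
    refine LinearMap.ext fun f => ?_
    have h : (⁅X, Y⁆ : G n).1 = comm X.1 Y.1 := LieAlgebra.SpecialLinear.sl_bracket _ _ _ _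
    rw [LieRing.of_associative_ring_bracket]
    change wDer (⁅X, Y⁆ : G n).1 f + twist c (⁅X, Y⁆ : G n).1 * f =
      (wDer X.1 (wDer Y.1 f + twist c Y.1 * f) + twist c X.1 * (wDer Y.1 f + twist c Y.1 * f)) -
      (wDer Y.1 (wDer X.1 f + twist c X.1 * f) + twist c Y.1 * (wDer X.1 f + twist c X.1 * f))
    rw [h, wDer_comm, twist_comm, map_add, map_add, Derivation.leibniz, Derivation.leibniz]
    simp only [smul_eq_mul]
    ring

theorem wRep_apply (c : Fin (n + 1) → ℂ) (X : G n) (f : WRing n) :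
    wRep c X f = wDer X.1 f + twist c X.1 * f := rfl

theorem wRep_apply_one (c : Fin (n + 1) → ℂ) (X : G n) : wRep c X 1 = twist c X.1 := by
  rw [wRep_apply, Derivation.map_one_eq_zero, zero_add, mul_one]

theorem upperTriangular_mul_diag {N A : Type*} [Fintype N] [LinearOrder N] [CommRing A]
    {M M' : Matrix N N A} (h : M.BlockTriangular id) (h' : M'.BlockTriangular id) (i : N) :
    (M * M') i i = M i i * M' i i := by
  rw [Matrix.mul_apply, Finset.sum_eq_single i]
  · intro p _ hp
    rcases lt_or_gt_of_ne hp with hp | hp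
    · rw [h (show id p < id i from hp), zero_mul]
    · rw [h' (show id i < id p from hp), mul_zero]
  · simp

theorem unip_apply_self (i : Fin (n + 1)) : unip n i i = 1 := by simp [unip]

theorem inv_unip_blockTriangular : (unip n)⁻¹.BlockTriangular id :=
  have : Invertible (unip n) := (unip n).invertibleOfIsUnitDet (isUnit_det_unip n)
  Matrix.blockTriangular_inv_of_blockTriangular (unip_blockTriangular n)

theorem inv_unip_apply_self (i : Fin (n + 1)) : (unip n)⁻¹ i i = 1 := by
  have h := upperTriangular_mul_diag (unip_blockTriangular n) inv_unip_blockTriangular i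
  rw [Matrix.mul_nonsing_inv _ (isUnit_det_unip n), Matrix.one_apply_eq, unip_apply_self,
    one_mul] at h
  exact h.symm

/-- Unipotent conjugation keeps an upper triangular matrix upper triangular and preserves its
diagonal, so only the diagonal character survives. Hence the constant 1 is a vector of weight `lam`
for 𝔟. -/
theorem twist_borel (lam : Weight n) (b : borel n) :
    twist (fun i => lam (eps i)) b.1.1 = MvPolynomial.C (borelChar lam b) := by
  have hb : (b.1.1.map (MvPolynomial.C : ℂ → WRing n)).BlockTriangular id := fun i j h => by
    rw [Matrix.map_apply, b.2 i j h, map_zero]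
  have hu := (unip_blockTriangular n).mul hb
  have h1 : ∀ j : Fin n, conj b.1.1 j.succ j.castSucc = 0 := fun j =>
    hu.mul inv_unip_blockTriangular (show id j.castSucc < id j.succ from Fin.castSucc_lt_succ)
  have h2 : ∀ i, conj b.1.1 i i = MvPolynomial.C (b.1.1 i i) := fun i => by
    rw [conj, upperTriangular_mul_diag hu inv_unip_blockTriangular,
      upperTriangular_mul_diag (unip_blockTriangular n) hb, unip_apply_self, inv_unip_apply_self,
      one_mul, mul_one, Matrix.map_apply]
  have h3 : borelChar lam b = lam (diagPart n b) := rfl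
  rw [h3, weight_apply]
  simp only [twist, h1, h2, mul_zero, Finset.sum_const_zero, zero_add, map_sum, map_mul]
  refine Finset.sum_congr rfl fun i _ => ?_
  rw [mul_comm]
  congr 2
  exact (diagElt_apply _ (sum_diag b.1) i).symm

/-- The action of `U(𝔤)` on `WRing n`. -/
def wU (c : Fin (n + 1) → ℂ) : U n →ₐ[ℂ] Module.End ℂ (WRing n) :=
  UniversalEnvelopingAlgebra.lift ℂ (wRep c)

theorem wU_toU (c : Fin (n + 1) → ℂ) (x : G n) : wU c (toU x) = wRep c x :=
  UniversalEnvelopingAlgebra.lift_ι_apply ℂ _ x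

/-- To prove an identity between the values of two algebra maps on a vector, it suffices to check
it on the Lie algebra. -/
theorem algHom_apply_eq_smul {L V : Type*} [LieRing L] [LieAlgebra ℂ L] [AddCommGroup V]
    [Module ℂ V] (f : UniversalEnvelopingAlgebra ℂ L →ₐ[ℂ] Module.End ℂ V)
    (χ : UniversalEnvelopingAlgebra ℂ L →ₐ[ℂ] ℂ) (v : V)
    (h : ∀ x, f (UniversalEnvelopingAlgebra.ι ℂ x) v = χ (UniversalEnvelopingAlgebra.ι ℂ x) • v)
    (b : UniversalEnvelopingAlgebra ℂ L) : f b v = χ b • v := by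
  let S : Subalgebra ℂ (UniversalEnvelopingAlgebra ℂ L) :=
    { carrier := {b | f b v = χ b • v}
      mul_mem' := fun {a b} (ha : f a v = χ a • v) (hb : f b v = χ b • v) => by
        change f (a * b) v = χ (a * b) • v
        rw [map_mul, map_mul, Module.End.mul_apply, hb, map_smul, ha, smul_smul, mul_comm]
      add_mem' := fun {a b} (ha : f a v = χ a • v) (hb : f b v = χ b • v) => by
        change f (a + b) v = χ (a + b) • v
        rw [map_add, map_add, LinearMap.add_apply, ha, hb, add_smul]
      algebraMap_mem' := fun z => by
        change f (algebraMap _ _ z) v = χ (algebraMap _ _ z) • v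
        rw [AlgHom.commutes, AlgHom.commutes]
        rfl }
  let ιS : L →ₗ⁅ℂ⁆ S :=
    { toFun := fun x => ⟨UniversalEnvelopingAlgebra.ι ℂ x, h x⟩
      map_add' := fun x y => Subtype.ext (map_add _ x y)
      map_smul' := fun z x => Subtype.ext (map_smul _ z x)
      map_lie' := fun {x y} => Subtype.ext (LieHom.map_lie _ x y) }
  -- By the universal property, the lift to `S` followed by the inclusion is the identity, so `S` is
  -- the whole enveloping algebra.
  have hid : S.val.comp (UniversalEnvelopingAlgebra.lift ℂ ιS) = AlgHom.id ℂ _ := by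
    refine UniversalEnvelopingAlgebra.hom_ext ℂ (LieHom.ext fun x => ?_)
    change ((UniversalEnvelopingAlgebra.lift ℂ ιS (UniversalEnvelopingAlgebra.ι ℂ x) : S) :
      UniversalEnvelopingAlgebra ℂ L) = UniversalEnvelopingAlgebra.ι ℂ x
    rw [UniversalEnvelopingAlgebra.lift_ι_apply]
    rfl
  have hb : ((UniversalEnvelopingAlgebra.lift ℂ ιS b : S) : UniversalEnvelopingAlgebra ℂ L) = b :=
    DFunLike.congr_fun hid b
  rw [← hb]
  exact (UniversalEnvelopingAlgebra.lift ℂ ιS b).2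

theorem inclU_ι (b : borel n) : inclU n (UniversalEnvelopingAlgebra.ι ℂ b) = toU b.1 :=
  UniversalEnvelopingAlgebra.lift_ι_apply ℂ _ b

theorem charU_ι (lam : Weight n) (b : borel n) :
    charU lam (UniversalEnvelopingAlgebra.ι ℂ b) = borelChar lam b :=
  UniversalEnvelopingAlgebra.lift_ι_apply ℂ _ b

theorem wU_inclU_one (lam : Weight n) (b : UB n) :
    wU (fun i => lam (eps i)) (inclU n b) 1 = charU lam b • (1 : WRing n) := by
  refine algHom_apply_eq_smul ((wU _).comp (inclU n)) (charU lam) 1 (fun x => ?_) b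
  rw [AlgHom.comp_apply, inclU_ι, wU_toU, wRep_apply_one, twist_borel, charU_ι,
    MvPolynomial.smul_eq_C_mul, mul_one]

/-- The map `U(𝔤) ⊗ ℂ → WRing n`, `u ⊗ z ↦ z u 1`. -/
def wTensor (c : Fin (n + 1) → ℂ) : U n ⊗[ℂ] ℂ →ₗ[ℂ] WRing n :=
  LinearMap.applyₗ (1 : WRing n) ∘ₗ (wU c).toLinearMap ∘ₗ (TensorProduct.rid ℂ (U n)).toLinearMap

theorem wTensor_tmul (c : Fin (n + 1) → ℂ) (x : U n) (z : ℂ) :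
    wTensor c (x ⊗ₜ z) = z • wU c x 1 := by
  simp [wTensor]

theorem wTensor_smul (c : Fin (n + 1) → ℂ) (x : U n) (t : U n ⊗[ℂ] ℂ) :
    wTensor c (x • t) = wU c x (wTensor c t) := by
  induction t with
  | zero => simp
  | add s t hs ht => rw [smul_add, map_add, hs, ht, map_add, map_add]
  | tmul y z =>
    rw [TensorProduct.smul_tmul', wTensor_tmul, wTensor_tmul, smul_eq_mul, map_mul, map_smul,
      Module.End.mul_apply]

theorem wTensor_balance (lam : Weight n) {t : U n ⊗[ℂ] ℂ} (ht : t ∈ balance lam) :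
    wTensor (fun i => lam (eps i)) t = 0 := by
  induction ht using Submodule.span_induction with
  | mem t h =>
    obtain ⟨x, b, z, rfl⟩ := h
    rw [map_sub, wTensor_tmul, wTensor_tmul, map_mul, Module.End.mul_apply, wU_inclU_one, map_smul,
      smul_smul, mul_comm, sub_self]
  | zero => simp
  | add s t _ _ hs ht => rw [map_add, hs, ht, add_zero]
  | smul x t _ ht => rw [wTensor_smul, ht, map_zero]

/-- The evaluation at the base point. -/
def basePoint : WRing n →ₐ[ℂ] ℂ := MvPolynomial.aeval (Sum.elim (fun _ => 0) (fun _ => 1))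

theorem basePoint_inl (p : Fin (n + 1) × Fin (n + 1)) :
    basePoint (MvPolynomial.X (Sum.inl p) : WRing n) = 0 := by simp [basePoint]

theorem basePoint_inr (j : Fin n) :
    basePoint (MvPolynomial.X (Sum.inr j) : WRing n) = 1 := by simp [basePoint]

theorem map_basePoint_unip : (unip n).map basePoint = 1 := by
  ext1 i j
  rw [Matrix.map_apply, unip, Matrix.of_apply, Matrix.one_apply]
  by_cases h : i < j
  · rw [if_pos h, if_neg h.ne, basePoint_inl]
  · rw [if_neg h]
    split_ifs <;> simp

theorem map_basePoint_mul (M M' : Matrix (Fin (n + 1)) (Fin (n + 1)) (WRing n)) :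
    (M * M').map basePoint = M.map basePoint * M'.map basePoint :=
  Matrix.map_mul (f := (basePoint : WRing n →ₐ[ℂ] ℂ).toRingHom)

theorem basePoint_conj (X : Matrix (Fin (n + 1)) (Fin (n + 1)) ℂ) (i j : Fin (n + 1)) :
    basePoint (conj X i j) = X i j := by
  have h1 : (unip n)⁻¹.map basePoint = 1 := by
    have h := map_basePoint_mul (unip n) (unip n)⁻¹
    rw [Matrix.mul_nonsing_inv _ (isUnit_det_unip n), map_basePoint_unip, one_mul] at h
    rw [← h]
    ext1 i j
    rw [Matrix.map_apply, Matrix.one_apply, Matrix.one_apply]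
    split_ifs <;> simp
  have h2 : (X.map (MvPolynomial.C : ℂ → WRing n)).map basePoint = X := by
    ext1 i j
    simp [basePoint]
  have h : (conj X).map basePoint = X := by
    rw [conj, map_basePoint_mul, map_basePoint_mul, h1, h2, map_basePoint_unip, one_mul, mul_one]
  exact congr_fun (congr_fun h i) j

/-- At the identity `conj X` is X itself, whose strictly upper and diagonal parts are zero: the
vector field vanishes there and only the twist is left. -/
theorem basePoint_wDer {X : Matrix (Fin (n + 1)) (Fin (n + 1)) ℂ}
    (hX : ∀ i j, i ≤ j → X i j = 0) (f : WRing n) : basePoint (wDer X f) = 0 := by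
  induction f using MvPolynomial.induction_on with
  | C a => rw [show wDer X (MvPolynomial.C a) = 0 from MvPolynomial.derivation_C _ _, map_zero]
  | add p q hp hq => rw [map_add, map_add, hp, hq, add_zero]
  | mul_X p s hp =>
    have hs : basePoint (wDer X (MvPolynomial.X s)) = 0 := by
      rcases s with ⟨i, j⟩ | j
      · rw [wDer_inl, Matrix.mul_apply, map_sum]
        refine Finset.sum_eq_zero fun q _ => ?_
        rw [map_mul, strictUpper_apply]
        split_ifs with h
        · rw [basePoint_conj, hX _ _ h.le, zero_mul]
        · rw [map_zero, zero_mul]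
      · rw [wDer_inr, map_mul, map_sub, basePoint_conj, basePoint_conj, hX _ _ le_rfl,
          hX _ _ le_rfl, sub_self, zero_mul]
    rw [Derivation.leibniz, smul_eq_mul, smul_eq_mul, map_add, map_mul, map_mul, hp, hs, mul_zero,
      mul_zero, add_zero]

/-- The Whittaker functional on a Verma module. -/
theorem exists_whittaker (lam : Weight n) : ∃ ψ : Verma lam →ₗ[ℂ] ℂ, ψ (vac lam) = 1 ∧
    ∀ (p : NegIdx n) (w : Verma lam),
      ψ (toU (E p) • w) = (if (p.1.2 : ℕ) + 1 = p.1.1 then 1 else 0) * ψ w := by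
  set c : Fin (n + 1) → ℂ := fun i => lam (eps i) with hc
  -- `wTensor` is only ℂ-linear, so the quotient is taken over ℂ.
  let θ : (U n ⊗[ℂ] ℂ ⧸ (balance lam).restrictScalars ℂ) →ₗ[ℂ] WRing n :=
    ((balance lam).restrictScalars ℂ).liftQ (wTensor c) fun t ht => wTensor_balance lam ht
  refine ⟨basePoint.toLinearMap ∘ₗ θ ∘ₗ
    (Submodule.Quotient.restrictScalarsEquiv ℂ (balance lam)).symm.toLinearMap, ?_, ?_⟩
  · change basePoint (wTensor c (1 ⊗ₜ 1)) = 1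
    rw [wTensor_tmul, map_one (wU c), one_smul, Module.End.one_apply]
    exact map_one basePoint
  · intro p w
    obtain ⟨t, rfl⟩ := Submodule.Quotient.mk_surjective _ w
    change basePoint (wTensor c (toU (E p) • t)) = _ * basePoint (wTensor c t)
    have hE : ∀ i j, (E p).1 i j = if p.1.1 = i ∧ p.1.2 = j then 1 else 0 := fun i j => by
      rw [E, LieAlgebra.SpecialLinear.val_single]
      exact Matrix.single_apply ..
    rw [wTensor_smul, wU_toU, wRep_apply, map_add, map_mul, basePoint_wDer, zero_add]
    · congr 1
      simp only [twist, map_add, map_sum, map_mul, basePoint_conj, basePoint_inr, one_mul]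
      rw [Finset.sum_eq_zero (s := (Finset.univ : Finset (Fin (n + 1)))), add_zero]
      · split_ifs with h
        · obtain ⟨⟨i, j⟩, hij⟩ := p
          have hv : j.1 + 1 = i.1 := h
          have hjn : j.1 < n := by have := i.2; omega
          rw [Finset.sum_eq_single ⟨j.1, hjn⟩]
          · rw [hE, if_pos]
            constructor <;> ext <;> simp [hv]
          · intro q _ hq
            rw [hE, if_neg]
            rintro ⟨-, h2⟩
            exact hq (Fin.ext (congrArg Fin.val h2).symm)
          · simp
        · refine Finset.sum_eq_zero fun q _ => ?_
          rw [hE, if_neg]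
          rintro ⟨h1, h2⟩
          exact h (by rw [h1, h2]; simp)
      · intro q _
        rw [hE, if_neg, mul_zero]
        rintro ⟨h1, h2⟩
        exact p.2.ne (h2.trans h1.symm)
    · intro i j hij
      rw [hE, if_neg]
      rintro ⟨rfl, rfl⟩
      exact absurd p.2 (not_lt.2 hij)

end Whittaker

/-! ### A polynomial representation in which negative root vectors act injectively -/

section Faithful

variable {n : ℕ}

/-- The action of a matrix on polynomials by a linear vector field. -/
def linDer (X : Matrix (Fin (n + 1)) (Fin (n + 1)) ℂ) :
    Derivation ℂ (MvPolynomial (Fin (n + 1)) ℂ) (MvPolynomial (Fin (n + 1)) ℂ) :=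
  MvPolynomial.mkDerivation ℂ fun q => ∑ p, X p q • MvPolynomial.X p

theorem linDer_X (X : Matrix (Fin (n + 1)) (Fin (n + 1)) ℂ) (q : Fin (n + 1)) :
    linDer X (MvPolynomial.X q) = ∑ p, X p q • MvPolynomial.X p :=
  MvPolynomial.mkDerivation_X ..

theorem linDer_add (X Y : Matrix (Fin (n + 1)) (Fin (n + 1)) ℂ) :
    linDer (X + Y) = linDer X + linDer Y := by
  refine MvPolynomial.derivation_ext fun q => ?_
  simp only [Derivation.add_apply, linDer_X, Matrix.add_apply, add_smul, Finset.sum_add_distrib]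

theorem linDer_smul (c : ℂ) (X : Matrix (Fin (n + 1)) (Fin (n + 1)) ℂ) :
    linDer (c • X) = c • linDer X := by
  refine MvPolynomial.derivation_ext fun q => ?_
  simp only [Derivation.smul_apply, linDer_X, Matrix.smul_apply, Finset.smul_sum, smul_smul,
    smul_eq_mul]

theorem linDer_comm (X Y : Matrix (Fin (n + 1)) (Fin (n + 1)) ℂ)
    (f : MvPolynomial (Fin (n + 1)) ℂ) :
    linDer (comm X Y) f = linDer X (linDer Y f) - linDer Y (linDer X f) := by
  have h : ∀ (X Y : Matrix (Fin (n + 1)) (Fin (n + 1)) ℂ) q,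
      linDer X (linDer Y (MvPolynomial.X q)) = linDer (X * Y) (MvPolynomial.X q) := fun X Y q => by
    simp only [linDer_X, map_sum, Derivation.map_smul, Finset.smul_sum, smul_smul,
      Matrix.mul_apply, Finset.sum_smul]
    rw [Finset.sum_comm]
    simp only [mul_comm]
  have key : linDer (comm X Y) = ⁅linDer X, linDer Y⁆ := by
    refine MvPolynomial.derivation_ext fun q => ?_
    rw [Derivation.commutator_apply, h, h, comm, sub_eq_add_neg, linDer_add,
      ← neg_one_smul ℂ (Y * X), linDer_smul, Derivation.add_apply, Derivation.smul_apply,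
      neg_one_smul, sub_eq_add_neg]
  rw [key, Derivation.commutator_apply]

/-- The linear vector fields, twisted by the exponential of the sum of the variables. -/
def linRep : G n →ₗ⁅ℂ⁆ Module.End ℂ (MvPolynomial (Fin (n + 1)) ℂ) where
  toFun X := (linDer X.1).toLinearMap +
    LinearMap.mulLeft ℂ (linDer X.1 (∑ q, MvPolynomial.X q))
  map_add' X Y := by
    refine LinearMap.ext fun f => ?_
    change linDer (X.1 + Y.1) f + linDer (X.1 + Y.1) _ * f =
      (linDer X.1 f + linDer X.1 _ * f) + (linDer Y.1 f + linDer Y.1 _ * f)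
    rw [linDer_add, Derivation.add_apply, Derivation.add_apply]
    ring
  map_smul' z X := by
    refine LinearMap.ext fun f => ?_
    change linDer (z • X.1) f + linDer (z • X.1) _ * f = z • (linDer X.1 f + linDer X.1 _ * f)
    rw [linDer_smul, Derivation.smul_apply, Derivation.smul_apply, smul_add, smul_mul_assoc]
  map_lie' {X Y} := by
    refine LinearMap.ext fun f => ?_
    have h : (⁅X, Y⁆ : G n).1 = comm X.1 Y.1 := LieAlgebra.SpecialLinear.sl_bracket _ _ _ _
    rw [LieRing.of_associative_ring_bracket]
    change linDer (⁅X, Y⁆ : G n).1 f + linDer (⁅X, Y⁆ : G n).1 _ * f =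
      (linDer X.1 (linDer Y.1 f + linDer Y.1 _ * f) +
        linDer X.1 _ * (linDer Y.1 f + linDer Y.1 _ * f)) -
      (linDer Y.1 (linDer X.1 f + linDer X.1 _ * f) +
        linDer Y.1 _ * (linDer X.1 f + linDer X.1 _ * f))
    rw [h, linDer_comm, linDer_comm, map_add, map_add, Derivation.leibniz, Derivation.leibniz]
    simp only [smul_eq_mul]
    ring

/-- Conjugating X_i ∂_j by the exponential of the sum of the variables turns ∂_j, which has a
kernel, into ∂_j + 1, which has none on polynomials. -/
theorem linRep_E (p : NegIdx n) (f : MvPolynomial (Fin (n + 1)) ℂ) :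
    linRep (E p) f = MvPolynomial.X p.1.1 * (MvPolynomial.pderiv p.1.2 f + f) := by
  have h : linDer (E p).1 = (MvPolynomial.X p.1.1 : MvPolynomial (Fin (n + 1)) ℂ) •
      MvPolynomial.pderiv p.1.2 := by
    refine MvPolynomial.derivation_ext fun q => ?_
    rw [linDer_X, E, LieAlgebra.SpecialLinear.val_single, Derivation.smul_apply,
      MvPolynomial.pderiv_X, Finset.sum_eq_single p.1.1]
    · by_cases hq : p.1.2 = q
      · subst hq; simp
      · rw [Matrix.single_apply, if_neg (fun h => hq h.2), Pi.single_eq_of_ne' hq]; simp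
    · intro r _ hr
      rw [Matrix.single_apply, if_neg (fun h => hr h.1.symm), zero_smul]
    · simp
  change linDer (E p).1 f + linDer (E p).1 _ * f = _
  rw [h, Derivation.smul_apply, Derivation.smul_apply, map_sum]
  simp only [MvPolynomial.pderiv_X, smul_eq_mul]
  rw [Finset.sum_eq_single p.1.2]
  · simp; ring
  · intro q _ hq
    exact Pi.single_eq_of_ne hq _
  · simp

/-- A monomial of f of maximal degree in variable i receives nothing from the derivative. -/
theorem pderiv_add_self_ne_zero {σ : Type*} (i : σ) {f : MvPolynomial σ ℂ} (hf : f ≠ 0) :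
    MvPolynomial.pderiv i f + f ≠ 0 := by
  obtain ⟨d, hd, hmax⟩ := Finset.exists_max_image f.support (fun d => d i)
    (MvPolynomial.support_nonempty.2 hf)
  have h0 : MvPolynomial.coeff (d + Finsupp.single i 1) f = 0 := by
    by_contra h
    have := hmax _ (MvPolynomial.mem_support_iff.2 h)
    simp at this
  intro h
  have := congrArg (MvPolynomial.coeff d) h
  rw [MvPolynomial.coeff_add, MvPolynomial.coeff_pderiv, h0] at this
  simp at this
  exact MvPolynomial.mem_support_iff.1 hd this

theorem linRep_E_ne_zero (p : NegIdx n) {f : MvPolynomial (Fin (n + 1)) ℂ} (hf : f ≠ 0) :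
    linRep (E p) f ≠ 0 := by
  rw [linRep_E]
  exact mul_ne_zero (MvPolynomial.X_ne_zero _) (pderiv_add_self_ne_zero _ hf)

end Faithful

/-! ### Ordered monomials and their weights -/

section OrderedProducts

variable {n : ℕ}

/-- The pairs `(i, j)` with `j < i` in lexicographic order. -/
def negList (n : ℕ) : List (NegIdx n) :=
  (List.finRange (n + 1)).flatMap fun i =>
    (List.finRange (n + 1)).filterMap fun j => if h : j < i then some ⟨(i, j), h⟩ else none

/-- The lexicographic order on pairs. -/
def lexLt (p q : NegIdx n) : Prop := p.1.1 < q.1.1 ∨ p.1.1 = q.1.1 ∧ p.1.2 < q.1.2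

theorem mem_negList (p : NegIdx n) : p ∈ negList n := by
  obtain ⟨⟨i, j⟩, h⟩ := p
  simp only [negList, List.mem_flatMap, List.mem_filterMap]
  exact ⟨i, List.mem_finRange i, j, List.mem_finRange j, dif_pos h⟩

theorem negList_pairwise : (negList n).Pairwise lexLt := by
  rw [negList, List.pairwise_flatMap]
  constructor
  · intro i _
    rw [List.pairwise_filterMap]
    refine (List.pairwise_lt_finRange (n + 1)).imp fun {j j'} hj p hp q hq => ?_
    split_ifs at hp with h1
    split_ifs at hq with h2
    cases hp; cases hq
    exact Or.inr ⟨rfl, hj⟩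
  · refine (List.pairwise_lt_finRange (n + 1)).imp fun {i i'} hi p hp q hq => ?_
    rw [List.mem_filterMap] at hp hq
    obtain ⟨j, -, hj⟩ := hp
    obtain ⟨j', -, hj'⟩ := hq
    split_ifs at hj with h1
    split_ifs at hj' with h2
    cases hj; cases hj'
    exact Or.inl hi

theorem lexLt_irrefl (p : NegIdx n) : ¬ lexLt p p := by simp [lexLt]

theorem negList_nodup : (negList n).Nodup :=
  negList_pairwise.imp fun {p q} (h : lexLt p q) (hpq : p = q) => lexLt_irrefl q (hpq ▸ h)

/-- The product of the powers `E_p ^ a_p` in the order of a list. -/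
def oprod (L : List (NegIdx n)) (a : Expo n) : U n := (L.map fun p => toU (E p) ^ a p).prod

theorem oprod_nil (a : Expo n) : oprod [] a = 1 := rfl

theorem oprod_cons (p : NegIdx n) (L : List (NegIdx n)) (a : Expo n) :
    oprod (p :: L) a = toU (E p) ^ a p * oprod L a := by
  rw [oprod, List.map_cons, List.prod_cons, oprod]

theorem oprod_append (L L' : List (NegIdx n)) (a : Expo n) :
    oprod (L ++ L') a = oprod L a * oprod L' a := by
  rw [oprod, List.map_append, List.prod_append, oprod, oprod]

theorem oprod_congr {L : List (NegIdx n)} {a b : Expo n} (h : ∀ p ∈ L, a p = b p) :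
    oprod L a = oprod L b := by
  rw [oprod, oprod, List.map_congr_left fun p hp => by rw [h p hp]]

theorem mono_eq_oprod (a : Expo n) : mono a = oprod (negList n) a := by
  have h : ∀ (i : Fin (n + 1)) (L : List (Fin (n + 1))),
      (L.map fun j => if h : j < i then toU (E ⟨(i, j), h⟩) ^ a ⟨(i, j), h⟩ else 1).prod =
      oprod (L.filterMap fun j => if h : j < i then some ⟨(i, j), h⟩ else none) a := by
    intro i L
    induction L with
    | nil => rfl
    | cons j L ih =>
      rw [List.map_cons, List.prod_cons, ih]
      by_cases hj : j < i
      · rw [List.filterMap_cons_some (b := ⟨(i, j), hj⟩) (dif_pos hj), oprod_cons, dif_pos hj]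
      · rw [List.filterMap_cons_none (dif_neg hj), dif_neg hj, one_mul]
  have h2 : ∀ (L : List (Fin (n + 1))) (F : Fin (n + 1) → List (NegIdx n)),
      (L.map fun i => oprod (F i) a).prod = oprod (L.flatMap F) a := by
    intro L F
    induction L with
    | nil => rfl
    | cons i L ih => rw [List.map_cons, List.prod_cons, ih, List.flatMap_cons, oprod_append]
  rw [mono, negList, List.ofFn_eq_map, ← h2]
  simp only [List.ofFn_eq_map, h]

/-- Were E^a zero, a would satisfy every bracket condition and belong to every Γ_{k,l}^m. Each
factor acts injectively on polynomials, so E^a does not kill 1. -/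
theorem mono_ne_zero (a : Expo n) : mono a ≠ 0 := by
  have key : ∀ L : List (NegIdx n),
      UniversalEnvelopingAlgebra.lift ℂ linRep (oprod L a) (1 : MvPolynomial _ ℂ) ≠ 0 := by
    intro L
    induction L with
    | nil =>
      rw [oprod_nil, map_one (UniversalEnvelopingAlgebra.lift ℂ linRep)]
      exact one_ne_zero
    | cons p L ih =>
      rw [oprod_cons, map_mul, Module.End.mul_apply]
      generalize UniversalEnvelopingAlgebra.lift ℂ linRep (oprod L a) 1 = f at ih
      induction a p with
      | zero => rw [pow_zero, map_one]; exact ih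
      | succ k hk =>
        rw [pow_succ', map_mul, Module.End.mul_apply, toU,
          UniversalEnvelopingAlgebra.lift_ι_apply]
        exact linRep_E_ne_zero p hk
  intro h
  refine key (negList n) ?_
  rw [← mono_eq_oprod, h, map_zero, LinearMap.zero_apply]

theorem toU_mul_toU (x y : G n) : toU x * toU y = toU y * toU x + toU ⁅x, y⁆ := by
  rw [toU, toU, toU, LieHom.map_lie, LieRing.of_associative_ring_bracket]
  abel

theorem lie_cartan_E (H : cartan n) (p : NegIdx n) :
    ⁅H.1, E p⁆ = (e p.1.1 - e p.1.2) H • E p := by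
  apply Subtype.ext
  ext i j
  change (⁅H.1, E p⁆ : G n).1 i j = (H.1.1 p.1.1 p.1.1 - H.1.1 p.1.2 p.1.2) * (E p).1 i j
  rw [lie_entry, Finset.sum_eq_single i, Finset.sum_eq_single j]
  · rw [E, LieAlgebra.SpecialLinear.val_single, Matrix.single_apply]
    split_ifs with h
    · rw [h.1, h.2]; ring
    · ring
  · intro q _ hq; rw [H.2 q j hq, mul_zero]
  · simp
  · intro q _ hq; rw [H.2 i q hq.symm, zero_mul]
  · simp

/-- Moving an element past a power of another one on which it acts by a scalar. -/
theorem mul_pow_of_eigen {A : Type*} [Ring A] [Algebra ℂ A] {h x : A} {c : ℂ}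
    (hx : h * x = x * h + c • x) (k : ℕ) : h * x ^ k = x ^ k * h + (k * c) • x ^ k := by
  induction k with
  | zero => simp
  | succ k ih =>
    rw [pow_succ, ← mul_assoc, ih, add_mul, mul_assoc, hx, mul_add, mul_smul_comm, smul_mul_assoc,
      ← mul_assoc]
    push_cast
    module

theorem cartan_mul_oprod (H : cartan n) (L : List (NegIdx n)) (a : Expo n) :
    toU H.1 * oprod L a = oprod L a * toU H.1 +
      (L.map fun p => (a p : ℂ) * (e p.1.1 - e p.1.2) H).sum • oprod L a := by
  induction L with
  | nil => simp [oprod_nil]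
  | cons p L ih =>
    have h : toU H.1 * toU (E p) = toU (E p) * toU H.1 + (e p.1.1 - e p.1.2) H • toU (E p) := by
      rw [toU_mul_toU, lie_cartan_E, toU, toU, toU, map_smul]
    rw [oprod_cons, ← mul_assoc, mul_pow_of_eigen h, add_mul, mul_assoc, ih, List.map_cons,
      List.sum_cons, mul_add, smul_mul_assoc, mul_smul_comm, mul_assoc]
    module

/-- The weight of `E^a`. -/
def wt (a : Expo n) : Weight n := ∑ p : NegIdx n, (a p : ℂ) • (e p.1.1 - e p.1.2)

theorem sum_map_negList {M : Type*} [AddCommMonoid M] (f : NegIdx n → M) :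
    ((negList n).map f).sum = ∑ p, f p := by
  rw [← List.sum_toFinset f negList_nodup]
  congr 1
  ext p
  simp [mem_negList]

theorem cartan_mul_mono (H : cartan n) (a : Expo n) :
    toU H.1 * mono a = mono a * toU H.1 + wt a H • mono a := by
  rw [mono_eq_oprod, cartan_mul_oprod, sum_map_negList]
  simp [wt]

theorem mem_weightExpo {k l : Fin (n + 1)} {m : ℕ} {a : Expo n} :
    a ∈ weightExpo k l m ↔ wt a = (m : ℂ) • (e l - e k) := by
  have h : ∀ H : cartan n, ⁅toU H.1, mono a⁆ = wt a H • mono a := fun H => by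
    rw [LieRing.of_associative_ring_bracket, cartan_mul_mono, add_sub_cancel_left]
  constructor
  · intro ha
    refine LinearMap.ext fun H => ?_
    have := ha H
    rw [h] at this
    exact smul_left_injective ℂ (mono_ne_zero a) this
  · intro ha H
    rw [h, ha]
    rfl

/-- The element of `𝔥` whose diagonal is `d` up to a constant. -/
def coweight (d : Fin (n + 1) → ℂ) : cartan n := ∑ i, d i • eps i

theorem sub_coweight (d : Fin (n + 1) → ℂ) (i j : Fin (n + 1)) :
    (e i - e j) (coweight d) = d i - d j := by
  have h : ∀ i, e i (coweight d) = d i - (∑ q, d q) * ((n : ℂ) + 1)⁻¹ := fun i => by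
    simp only [coweight, map_sum, map_smul, smul_eq_mul]
    change ∑ q, d q * (eps q).1.1 i i = _
    simp only [eps_apply, mul_sub, Finset.sum_sub_distrib, ← Finset.sum_mul]
    simp
  rw [LinearMap.sub_apply, h, h]
  ring

theorem wt_coweight (a : Expo n) (d : Fin (n + 1) → ℂ) :
    wt a (coweight d) = ∑ p : NegIdx n, (a p : ℂ) * (d p.1.1 - d p.1.2) := by
  simp only [wt, LinearMap.sum_apply, LinearMap.smul_apply, sub_coweight, smul_eq_mul]

/-- The number of arrows of `a` that cross from `S` to its complement, for a lower set `S`. -/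
theorem wt_lower (a : Expo n) (S : Fin (n + 1) → Prop) [DecidablePred S]
    (hS : ∀ i j, i ≤ j → S j → S i) :
    wt a (coweight fun i => if S i then 1 else 0) =
      - ((∑ p : NegIdx n with S p.1.2 ∧ ¬ S p.1.1, a p : ℕ) : ℂ) := by
  rw [wt_coweight, Finset.sum_filter, Nat.cast_sum, ← Finset.sum_neg_distrib]
  refine Finset.sum_congr rfl fun p _ => ?_
  have := hS p.1.2 p.1.1 p.2.le
  by_cases h1 : S p.1.1 <;> by_cases h2 : S p.1.2 <;> simp_all

/-- Each entry is at most the total crossing the cut just after its source node, and that total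
depends only on the weight. -/
theorem finite_wt_eq (μ : Weight n) : {a : Expo n | wt a = μ}.Finite := by
  rcases Set.eq_empty_or_nonempty {a : Expo n | wt a = μ} with h | ⟨b, hb⟩
  · rw [h]; exact Set.finite_empty
  refine (Set.finite_Iic fun p : NegIdx n =>
    ∑ q : NegIdx n with q.1.2 ≤ p.1.2 ∧ ¬ q.1.1 ≤ p.1.2, b q).subset fun a ha => ?_
  intro p
  have h1 := wt_lower a (· ≤ p.1.2) fun i j h h' => h.trans h'
  have h2 := wt_lower b (· ≤ p.1.2) fun i j h h' => h.trans h'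
  rw [show wt a = wt b from Eq.trans ha (Eq.symm hb), h2, neg_inj, Nat.cast_inj] at h1
  refine le_trans ?_ h1.ge
  exact Finset.single_le_sum (f := a) (fun _ _ => Nat.zero_le _)
    (Finset.mem_filter.2 ⟨Finset.mem_univ p, le_rfl, not_le.2 p.2⟩)

end OrderedProducts

section

variable {n : ℕ}

/-! ### The form, ρ and simple coroots -/

section Weights

theorem e_eps (i j : Fin (n + 1)) :
    e i (eps j) = (if i = j then 1 else 0) - ((n : ℂ) + 1)⁻¹ := eps_apply j i

theorem form_sub_e (μ : Weight n) (k l : Fin (n + 1)) :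
    form μ (e k - e l) = μ (eps k) - μ (eps l) := by
  have h : ∀ i, μ (eps i) * (e k - e l : Weight n) (eps i) =
      (if k = i then μ (eps i) else 0) - (if l = i then μ (eps i) else 0) := fun i => by
    rw [LinearMap.sub_apply, e_eps, e_eps]
    split_ifs <;> ring
  simp only [form, h, Finset.sum_sub_distrib]
  simp

theorem rho_eps (i : Fin (n + 1)) : rho n (eps i) = ((n : ℂ) - 2 * (i : ℕ)) / 2 := by
  have h : ∀ p q : Fin (n + 1), (if p < q then (e p - e q : Weight n) (eps i) else 0) =
      (if p = i then (if i < q then 1 else 0) else 0) -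
        (if q = i then (if p < i then 1 else 0) else 0) := fun p q => by
    rw [LinearMap.sub_apply, e_eps, e_eps]
    split_ifs with h1 h2 h3 <;> first | (exfalso; subst_vars; omega) | ring
  have h2 : ((Finset.univ.filter fun q => i < q).card : ℂ) = n - (i : ℕ) := by
    rw [Finset.filter_lt_eq_Ioi, Fin.card_Ioi]
    have := i.2
    rw [Nat.cast_sub (by omega)]
    push_cast; ring
  have h3 : ((Finset.univ.filter fun q => q < i).card : ℂ) = (i : ℕ) := by
    rw [Finset.filter_gt_eq_Iio, Fin.card_Iio]
  rw [rho, LinearMap.smul_apply, LinearMap.sum_apply, Finset.sum_filter, Fintype.sum_prod_type]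
  simp only [h, Finset.sum_sub_distrib]
  rw [Finset.sum_comm (s := Finset.univ) (t := Finset.univ)]
  simp only [Finset.sum_ite_eq', Finset.mem_univ, if_true, Finset.sum_boole]
  rw [h2, h3, smul_eq_mul]
  ring

/-- The simple coroot. -/
def coroot (i : Fin n) : cartan n := eps i.castSucc - eps i.succ

theorem simpleCoord_eq (lam : Weight n) (i : Fin n) :
    simpleCoord lam i = lam (coroot i) + 1 := by
  rw [simpleCoord, form_sub_e, coroot, map_sub, LinearMap.add_apply, LinearMap.add_apply, rho_eps,
    rho_eps]
  simp only [Fin.val_castSucc, Fin.val_succ]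
  push_cast; ring

end Weights

/-! ### Brackets of root vectors, and commutators with powers -/

section Brackets

/-- The simple root vector `E_{i,i+1}`. -/
def raise (i : Fin n) : G n :=
  LieAlgebra.SpecialLinear.single i.castSucc i.succ Fin.castSucc_lt_succ.ne 1

theorem val_E (p : NegIdx n) : (E p).1 = Matrix.single p.1.1 p.1.2 1 := rfl

theorem val_raise (i : Fin n) : (raise i).1 = Matrix.single i.castSucc i.succ 1 := rfl

theorem val_lie (x y : G n) : (⁅x, y⁆ : G n).1 = x.1 * y.1 - y.1 * x.1 :=
  LieAlgebra.SpecialLinear.sl_bracket _ _ _ _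

theorem lie_E_E {p q : NegIdx n} (h : p.1.2 ≠ q.1.1) (h' : q.1.2 ≠ p.1.1) : ⁅E p, E q⁆ = 0 := by
  apply Subtype.ext
  rw [val_lie, val_E, val_E, Matrix.single_mul_single_of_ne _ _ _ _ h,
    Matrix.single_mul_single_of_ne _ _ _ _ h', sub_zero]
  rfl

theorem lie_raise_E_of_ne {i : Fin n} {p : NegIdx n} (h : p.1.1 ≠ i.succ)
    (h' : p.1.2 ≠ i.castSucc) : ⁅raise i, E p⁆ = 0 := by
  apply Subtype.ext
  rw [val_lie, val_E, val_raise, Matrix.single_mul_single_of_ne _ _ _ _ h.symm,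
    Matrix.single_mul_single_of_ne _ _ _ _ h', sub_zero]
  rfl

theorem lie_raise_E_row {i : Fin n} {p s : NegIdx n} (h : p.1.1 = i.succ)
    (h1 : s.1.1 = i.castSucc) (h2 : s.1.2 = p.1.2) : ⁅raise i, E p⁆ = E s := by
  have h' : p.1.2 ≠ i.castSucc := fun h3 => s.2.ne (h2.trans (h3.trans h1.symm))
  apply Subtype.ext
  rw [val_lie, val_E, val_E, val_raise, Matrix.single_mul_single_of_ne _ _ _ _ h', sub_zero, h,
    Matrix.single_mul_single_same, h1, h2, one_mul]

theorem lie_raise_E_col {i : Fin n} {p s : NegIdx n} (h : p.1.2 = i.castSucc)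
    (h1 : s.1.1 = p.1.1) (h2 : s.1.2 = i.succ) : ⁅raise i, E p⁆ = - E s := by
  have h' : i.succ ≠ p.1.1 := fun h3 => s.2.ne (h2.trans (h3.trans h1.symm))
  apply Subtype.ext
  change (⁅raise i, E p⁆ : G n).1 = - (E s).1
  rw [val_lie, val_E, val_E, val_raise, Matrix.single_mul_single_of_ne _ _ _ _ h', zero_sub, h,
    Matrix.single_mul_single_same, h1, h2, one_mul]

theorem lie_raise_E_simple {i : Fin n} {p : NegIdx n} (h : p.1.1 = i.succ)
    (h' : p.1.2 = i.castSucc) : ⁅raise i, E p⁆ = (coroot i).1 := by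
  apply Subtype.ext
  rw [val_lie, val_E, val_raise, h, h', Matrix.single_mul_single_same,
    Matrix.single_mul_single_same, one_mul]
  change _ = Matrix.diagonal _ - Matrix.diagonal _
  ext a b
  simp only [Matrix.sub_apply, Matrix.single_apply, Matrix.diagonal_apply]
  by_cases hab : a = b
  · subst hab; simp [eq_comm]
  · have h1 : ∀ c : Fin (n + 1), ¬ (c = a ∧ c = b) := fun c h => hab (h.1.symm.trans h.2)
    simp [hab, h1]

theorem commute_toU {x y : G n} (h : ⁅x, y⁆ = 0) : Commute (toU x) (toU y) := by
  rw [commute_iff_eq, toU_mul_toU, h, show toU (0 : G n) = 0 from map_zero _, add_zero]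

theorem commute_E {p q : NegIdx n} (h : p.1.2 ≠ q.1.1) (h' : q.1.2 ≠ p.1.1) :
    Commute (toU (E p)) (toU (E q)) := commute_toU (lie_E_E h h')

/-- The k Leibniz terms coincide since z slides past y. At k = 0 the truncated exponent k - 1 is
harmless because of the factor k. -/
theorem commutator_pow_of_commute {A : Type*} [Ring A] [Algebra ℂ A] {x y z : A}
    (hxy : x * y = y * x + z) (hz : Commute y z) (k : ℕ) :
    x * y ^ k = y ^ k * x + (k : ℂ) • (y ^ (k - 1) * z) := by
  induction k with
  | zero => simp
  | succ k ih =>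
    rw [pow_succ, ← mul_assoc, ih, add_mul, mul_assoc, hxy, mul_add, smul_mul_assoc, mul_assoc,
      ← hz.eq, ← mul_assoc, ← mul_assoc, Nat.add_sub_cancel]
    rcases k with _ | k
    · simp
    · rw [Nat.add_sub_cancel, ← pow_succ y k, add_assoc]
      push_cast
      module

/-- The 𝔰𝔩₂ identity [x, y^k] = k y^{k-1}(h - k + 1). -/
theorem commutator_pow_sl2 {A : Type*} [Ring A] [Algebra ℂ A] {x y h : A}
    (hxy : x * y = y * x + h) (hy : h * y = y * h + (-2 : ℂ) • y) (k : ℕ) :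
    x * y ^ k = y ^ k * x + (k : ℂ) • (y ^ (k - 1) * h) - ((k : ℂ) * (k - 1)) • y ^ (k - 1) := by
  induction k with
  | zero => simp
  | succ k ih =>
    rw [pow_succ, ← mul_assoc, ih, sub_mul, add_mul, mul_assoc, hxy, mul_add, smul_mul_assoc,
      mul_assoc, hy, mul_add, mul_smul_comm, ← mul_assoc, ← mul_assoc, Nat.add_sub_cancel,
      smul_mul_assoc]
    rcases k with _ | k
    · simp
    · rw [Nat.add_sub_cancel, ← pow_succ y k, add_assoc]
      push_cast
      module

end Brackets

/-! ### Inserting a root vector into an ordered product -/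

section Insertion

/-- The exponent of a single root vector. -/
def delta (p : NegIdx n) : Expo n := Pi.single p 1

theorem delta_self (p : NegIdx n) : delta p p = 1 := Pi.single_eq_same ..

theorem delta_of_ne {p q : NegIdx n} (h : q ≠ p) : delta p q = 0 := Pi.single_eq_of_ne h _

theorem lexLt_ne {p q : NegIdx n} (h : lexLt p q) : p ≠ q := fun h' => lexLt_irrefl q (h' ▸ h)

theorem commute_oprod {x : U n} {L : List (NegIdx n)} (a : Expo n)
    (h : ∀ p ∈ L, Commute x (toU (E p))) : Commute x (oprod L a) := by
  induction L with
  | nil => exact Commute.one_right x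
  | cons p L ih =>
    rw [oprod_cons]
    exact ((h p List.mem_cons_self).pow_right _).mul_right
      (ih fun q hq => h q (List.mem_cons_of_mem _ hq))

theorem exists_split {L : List (NegIdx n)} (hL : L.Pairwise lexLt) {s : NegIdx n} (hs : s ∈ L) :
    ∃ A B, L = A ++ s :: B ∧ (∀ t ∈ A, lexLt t s) ∧ ∀ t ∈ B, lexLt s t := by
  obtain ⟨A, B, rfl⟩ := List.append_of_mem hs
  rw [List.pairwise_append, List.pairwise_cons] at hL
  exact ⟨A, B, rfl, fun t ht => hL.2.2 t ht s List.mem_cons_self, hL.2.1.1⟩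

theorem oprod_add_delta {A B : List (NegIdx n)} {s : NegIdx n} (hA : ∀ t ∈ A, lexLt t s)
    (hB : ∀ t ∈ B, lexLt s t) (a : Expo n) :
    oprod (A ++ s :: B) (a + delta s) = oprod A a * (toU (E s) ^ (a s + 1) * oprod B a) := by
  rw [oprod_append, oprod_cons, Pi.add_apply, delta_self]
  congr 1
  · exact oprod_congr fun t ht => by
      rw [Pi.add_apply, delta_of_ne (lexLt_ne (hA t ht)), add_zero]
  · congr 1
    exact oprod_congr fun t ht => by
      rw [Pi.add_apply, delta_of_ne (lexLt_ne (hB t ht)).symm, add_zero]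

theorem oprod_mul_E {L : List (NegIdx n)} (hL : L.Pairwise lexLt) {s : NegIdx n} (hs : s ∈ L)
    (hc : ∀ t ∈ L, lexLt s t → Commute (toU (E s)) (toU (E t))) (a : Expo n) :
    oprod L a * toU (E s) = oprod L (a + delta s) := by
  obtain ⟨A, B, rfl, hA, hB⟩ := exists_split hL hs
  have h : Commute (toU (E s)) (oprod B a) := commute_oprod a fun t ht =>
    hc t (List.mem_append_right _ (List.mem_cons_of_mem _ ht)) (hB t ht)
  rw [oprod_add_delta hA hB, oprod_append, oprod_cons, mul_assoc, mul_assoc, ← h.eq, ← mul_assoc,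
    ← mul_assoc, ← mul_assoc, mul_assoc _ _ (toU (E s)), ← pow_succ, mul_assoc]

theorem E_mul_oprod {L : List (NegIdx n)} (hL : L.Pairwise lexLt) {s : NegIdx n} (hs : s ∈ L)
    (hc : ∀ t ∈ L, lexLt t s → Commute (toU (E s)) (toU (E t))) (a : Expo n) :
    toU (E s) * oprod L a = oprod L (a + delta s) := by
  obtain ⟨A, B, rfl, hA, hB⟩ := exists_split hL hs
  have h : Commute (toU (E s)) (oprod A a) := commute_oprod a fun t ht =>
    hc t (List.mem_append_left _ ht) (hA t ht)
  rw [oprod_add_delta hA hB, oprod_append, oprod_cons, ← mul_assoc, h.eq, pow_succ', mul_assoc,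
    mul_assoc]

end Insertion

end

section

variable {n : ℕ}

/-! ### Action of simple root vectors on monomials -/

section Action

variable {lam : Weight n}

theorem borel_smul_vac (b : borel n) : toU b.1 • vac lam = borelChar lam b • vac lam := by
  have h : (1 * inclU n (UniversalEnvelopingAlgebra.ι ℂ b)) ⊗ₜ[ℂ] (1 : ℂ) -
      (1 : U n) ⊗ₜ[ℂ] (charU lam (UniversalEnvelopingAlgebra.ι ℂ b) * 1) ∈ balance lam :=
    Submodule.subset_span ⟨1, _, 1, rfl⟩
  have h' := (Submodule.Quotient.eq (balance lam)).2 h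
  rw [inclU_ι, charU_ι, one_mul, mul_one] at h'
  have h1 : toU b.1 • vac lam = Submodule.Quotient.mk (p := balance lam) (toU b.1 ⊗ₜ[ℂ] 1) := by
    rw [vac, Submodule.mkQ_apply, ← Submodule.Quotient.mk_smul, TensorProduct.smul_tmul',
      smul_eq_mul, mul_one]
  rw [h1, h', vac, Submodule.mkQ_apply, ← Submodule.Quotient.mk_smul, TensorProduct.smul_tmul',
    TensorProduct.smul_tmul, smul_eq_mul, mul_one]

theorem raise_smul_vac (i : Fin n) : toU (raise i) • vac lam = 0 := by
  have hb : raise i ∈ borel n := fun a b h => by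
    rw [val_raise, Matrix.single_apply, if_neg]
    rintro ⟨rfl, rfl⟩
    exact absurd h (not_lt.2 Fin.castSucc_lt_succ.le)
  have h := borel_smul_vac (lam := lam) ⟨raise i, hb⟩
  have h0 : diagPart n ⟨raise i, hb⟩ = 0 := cartan_ext fun a => by
    refine (diagElt_apply _ (sum_diag (raise i)) a).trans ?_
    change (raise i).1 a a = 0
    rw [val_raise, Matrix.single_apply, if_neg]
    rintro ⟨h1, h2⟩
    exact Fin.castSucc_lt_succ.ne (h1.trans h2.symm)
  have h1 : borelChar lam ⟨raise i, hb⟩ = 0 := by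
    change lam (diagPart n ⟨raise i, hb⟩) = 0
    rw [h0, map_zero]
  rw [h1, zero_smul] at h
  exact h

theorem cartan_smul_vac (H : cartan n) : toU H.1 • vac lam = lam H • vac lam := by
  have hb : H.1 ∈ borel n := fun a b h => H.2 a b h.ne'
  have h := borel_smul_vac (lam := lam) ⟨H.1, hb⟩
  have h0 : diagPart n ⟨H.1, hb⟩ = H := cartan_ext fun a => diagElt_apply _ (sum_diag H.1) a
  have h1 : borelChar lam ⟨H.1, hb⟩ = lam H := by
    change lam (diagPart n ⟨H.1, hb⟩) = _
    rw [h0]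
  rw [h1] at h
  exact h

theorem cartan_smul_oprod (H : cartan n) (L : List (NegIdx n)) (a : Expo n) :
    toU H.1 • oprod L a • vac lam =
      (lam H + (L.map fun p => (a p : ℂ) * (e p.1.1 - e p.1.2) H).sum) • oprod L a • vac lam := by
  rw [← mul_smul, cartan_mul_oprod, add_smul, mul_smul, cartan_smul_vac, add_smul,
    smul_comm (oprod L a) (lam H), smul_assoc]

theorem cartan_smul_mono (H : cartan n) (a : Expo n) :
    toU H.1 • mono a • vac lam = (lam H + wt a H) • mono a • vac lam := by
  rw [mono_eq_oprod, cartan_smul_oprod, sum_map_negList]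
  simp [wt]

/-- The total exponent of a column. -/
def colSum (a : Expo n) (x : Fin (n + 1)) : ℕ := ∑ p : NegIdx n with p.1.2 = x, a p

/-- The exponent that replaces `E_p` in its commutator with a simple root vector. -/
def shift (i : Fin n) (p : NegIdx n) : Expo n :=
  if h : p.1.1 = i.succ ∧ p.1.2 < i.castSucc then delta ⟨(i.castSucc, p.1.2), h.2⟩
  else if h : p.1.2 = i.castSucc ∧ i.succ < p.1.1 then delta ⟨(p.1.1, i.succ), h.2⟩
  else 0

/-- The coefficient in the action of a simple root vector on a monomial. -/
def raiseCoeff (lam : Weight n) (i : Fin n) (a : Expo n) (p : NegIdx n) : ℂ :=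
  if p.1.1 = i.succ then
    if p.1.2 = i.castSucc then
      a p * (simpleCoord lam i - colSum a i.castSucc + colSum a i.succ)
    else a p
  else if p.1.2 = i.castSucc then - a p else 0

theorem sub_delta_of_ne {a : Expo n} {p q : NegIdx n} (h : q ≠ p) : (a - delta p) q = a q := by
  rw [Pi.sub_apply, delta_of_ne h, Nat.sub_zero]

/-- A decomposition of the list of pairs at a pair `p`. -/
structure SplitAt (p : NegIdx n) (A B : List (NegIdx n)) : Prop where
  eq : A ++ p :: B = negList n

namespace SplitAt

variable {p : NegIdx n} {A B : List (NegIdx n)} (h : SplitAt p A B)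
include h

theorem pairwise : (A ++ p :: B).Pairwise lexLt := h.eq ▸ negList_pairwise

theorem left {q : NegIdx n} (hq : q ∈ A) : lexLt q p :=
  (List.pairwise_append.1 h.pairwise).2.2 q hq p List.mem_cons_self

theorem right {q : NegIdx n} (hq : q ∈ B) : lexLt p q :=
  (List.pairwise_cons.1 (List.pairwise_append.1 h.pairwise).2.1).1 q hq

theorem mem_left {q : NegIdx n} (hq : lexLt q p) : q ∈ A := by
  have hm : q ∈ A ++ p :: B := h.eq ▸ mem_negList q
  rcases List.mem_append.1 hm with hm | hm
  · exact hm
  rcases List.mem_cons.1 hm with rfl | hm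
  · exact absurd hq (lexLt_irrefl q)
  · have h1 := h.right hm
    simp only [lexLt] at h1 hq
    omega

theorem mem_right {q : NegIdx n} (hq : lexLt p q) : q ∈ B := by
  have hm : q ∈ A ++ p :: B := h.eq ▸ mem_negList q
  rcases List.mem_append.1 hm with hm | hm
  · have h1 := h.left hm
    simp only [lexLt] at h1 hq
    omega
  rcases List.mem_cons.1 hm with rfl | hm
  · exact absurd hq (lexLt_irrefl q)
  · exact hm

theorem mono_sub_delta (a : Expo n) (s : Expo n) (hs : s p = 0) :
    mono (a - delta p + s) = oprod A (a + s) * (toU (E p) ^ (a p - 1) * oprod B (a + s)) := by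
  rw [mono_eq_oprod, ← h.eq, oprod_append, oprod_cons, Pi.add_apply, Pi.sub_apply, delta_self, hs,
    add_zero]
  congr 1
  · exact oprod_congr fun q hq => by
      rw [Pi.add_apply, sub_delta_of_ne (lexLt_ne (h.left hq)), Pi.add_apply]
  · congr 1
    exact oprod_congr fun q hq => by
      rw [Pi.add_apply, sub_delta_of_ne (lexLt_ne (h.right hq)).symm, Pi.add_apply]

theorem pairwise_left : A.Pairwise lexLt := (List.pairwise_append.1 h.pairwise).1

theorem pairwise_right : B.Pairwise lexLt :=
  (List.pairwise_cons.1 (List.pairwise_append.1 h.pairwise).2.1).2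

theorem sum_right {M : Type*} [AddCommMonoid M] [DecidableRel (lexLt (n := n))]
    (f : NegIdx n → M) : (B.map f).sum = ∑ q, if lexLt p q then f q else 0 := by
  have hnd : B.Nodup :=
    h.pairwise_right.imp fun {p q} (h : lexLt p q) (hpq : p = q) => lexLt_irrefl q (hpq ▸ h)
  rw [← List.sum_toFinset f hnd, ← Finset.sum_filter]
  congr 1
  ext q
  simp only [List.mem_toFinset, Finset.mem_filter, Finset.mem_univ, true_and]
  exact ⟨h.right, h.mem_right⟩

/-- All factors after E_{i+1,i} lie in rows beyond i+1, so the coroot sees only their columns.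
Column i+1 lies entirely there, and column i does except for p, whence the correction a_p. -/
theorem weight_right {i : Fin n} (h1 : p.1.1 = i.succ) (h2 : p.1.2 = i.castSucc) (a : Expo n) :
    (B.map fun q => (a q : ℂ) * (e q.1.1 - e q.1.2) (coroot i)).sum =
      colSum a i.succ - colSum a i.castSucc + a p := by
  classical
  have hp : (a p : ℂ) = ∑ q, if q = p then (a q : ℂ) else 0 := by simp
  rw [h.sum_right, colSum, colSum, Nat.cast_sum, Nat.cast_sum, Finset.sum_filter,
    Finset.sum_filter, hp, ← Finset.sum_sub_distrib, ← Finset.sum_add_distrib]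
  refine Finset.sum_congr rfl fun q _ => ?_
  have hq := q.2
  have hqp : q = p ↔ q.1.1 = i.succ ∧ q.1.2 = i.castSucc := by
    rw [← h1, ← h2, Subtype.ext_iff, Prod.ext_iff]
  have hi : i.castSucc.1 + 1 = i.succ.1 := rfl
  by_cases hlt : lexLt p q
  · have hlt' := hlt
    simp only [lexLt, h1, h2] at hlt'
    have e1 : ¬ (q.1.1 = i.castSucc) := by rintro e; rw [e] at hlt' hq; omega
    have e2 : ¬ (q.1.1 = i.succ) := by rintro e; rw [e] at hlt' hq; omega
    rw [if_pos hlt, if_neg (fun e => e2 (hqp.1 e).1), coroot, map_sub, LinearMap.sub_apply,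
      LinearMap.sub_apply, e_eps, e_eps, e_eps, e_eps, if_neg e1, if_neg e2]
    split_ifs <;> ring
  · have hlt' := hlt
    simp only [lexLt, h1, h2] at hlt'
    have e1 : ¬ (q.1.2 = i.succ) := by rintro e; rw [e] at hlt' hq; omega
    rw [if_neg hlt, if_neg e1]
    by_cases e2 : q.1.2 = i.castSucc
    · have e3 : q.1.1 = i.succ := by rw [e2] at hlt' hq; omega
      rw [if_pos e2, if_pos (hqp.2 ⟨e3, e2⟩)]
      ring
    · rw [if_neg e2, if_neg fun e => e2 (hqp.1 e).2]
      ring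

/-- The commutator E_{i,j} must travel left to its place, past E_{i,j'} with j' > j and E_{i+1,j'}
with j' < j; it commutes with all of these. -/
theorem commutator_row {i : Fin n} (h1 : p.1.1 = i.succ) (h2 : p.1.2 < i.castSucc) (a : Expo n) :
    oprod A a * (toU (raise i) * toU (E p) ^ a p) * oprod B a =
      oprod A a * (toU (E p) ^ a p * toU (raise i)) * oprod B a +
        (a p : ℂ) • mono (a - delta p + delta ⟨(i.castSucc, p.1.2), h2⟩) := by
  set s : NegIdx n := ⟨(i.castSucc, p.1.2), h2⟩ with hs
  have hi : i.castSucc.1 + 1 = i.succ.1 := rfl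
  have hsp : lexLt s p := Or.inl (by rw [h1]; exact Fin.castSucc_lt_succ)
  have hbr : toU (raise i) * toU (E p) = toU (E p) * toU (raise i) + toU (E s) := by
    rw [toU_mul_toU, lie_raise_E_row (s := s) h1 rfl rfl]
  have hc : Commute (toU (E p)) (toU (E s)) :=
    commute_E h2.ne (by change p.1.2 ≠ p.1.1; exact p.2.ne)
  have hA : oprod A a * toU (E s) = oprod A (a + delta s) := by
    refine oprod_mul_E h.pairwise_left (h.mem_left hsp) (fun t ht hst => ?_) a
    have htp := h.left ht
    have ht' := t.2
    simp only [lexLt, h1, hs] at htp hst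
    refine commute_E (show p.1.2 ≠ t.1.1 from ?_) (show t.1.2 ≠ i.castSucc from ?_)
    · intro e; rw [← e] at hst; omega
    · intro e; rw [e] at htp ht'; omega
  have hB : oprod B (a + delta s) = oprod B a := oprod_congr fun t ht => by
    have hpt := h.right ht
    have : t ≠ s := by rintro rfl; simp only [lexLt] at hpt hsp; omega
    rw [Pi.add_apply, delta_of_ne this, add_zero]
  rw [commutator_pow_of_commute hbr hc, (hc.pow_left _).eq,
    h.mono_sub_delta _ _ (delta_of_ne (lexLt_ne hsp).symm), ← hA, hB]
  simp only [mul_add, add_mul, mul_smul_comm, smul_mul_assoc, mul_assoc]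

/-- The place of E_{q,i+1} is immediately after E_{q,i}, so its commutator is already in order. -/
theorem commutator_col {i : Fin n} (h1 : p.1.2 = i.castSucc) (h2 : i.succ < p.1.1) (a : Expo n) :
    oprod A a * (toU (raise i) * toU (E p) ^ a p) * oprod B a =
      oprod A a * (toU (E p) ^ a p * toU (raise i)) * oprod B a +
        (-(a p : ℂ)) • mono (a - delta p + delta ⟨(p.1.1, i.succ), h2⟩) := by
  set s : NegIdx n := ⟨(p.1.1, i.succ), h2⟩ with hs
  have hi : i.castSucc.1 + 1 = i.succ.1 := rfl
  have hps : lexLt p s := Or.inr ⟨rfl, by rw [h1]; exact Fin.castSucc_lt_succ⟩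
  have hbr : toU (raise i) * toU (E p) = toU (E p) * toU (raise i) + - toU (E s) := by
    rw [toU_mul_toU, lie_raise_E_col (s := s) h1 rfl rfl, show toU (- E s) = - toU (E s) from map_neg _ _]
  have hc : Commute (toU (E p)) (- toU (E s)) :=
    (commute_E (q := s) p.2.ne h2.ne).neg_right
  have hB : toU (E s) * oprod B a = oprod B (a + delta s) := by
    refine E_mul_oprod h.pairwise_right (h.mem_right hps) (fun t ht hts => ?_) a
    have hpt := h.right ht
    simp only [lexLt, h1, hs] at hpt hts
    omega
  have hA : oprod A (a + delta s) = oprod A a := oprod_congr fun t ht => by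
    have htp := h.left ht
    have : t ≠ s := by rintro rfl; simp only [lexLt] at htp hps; omega
    rw [Pi.add_apply, delta_of_ne this, add_zero]
  rw [commutator_pow_of_commute hbr hc, h.mono_sub_delta _ _ (delta_of_ne (lexLt_ne hps)), ← hB, hA]
  simp only [mul_add, add_mul, mul_smul_comm, smul_mul_assoc, mul_assoc, mul_neg, neg_mul, smul_neg,
    neg_smul]

/-- In a_p (h - a_p + 1), the a_p in the weight of the remaining factors cancels -a_p, and the 1
turns λ(h) into ⟨λ+ρ, α_i⟩. -/
theorem commutator_simple {i : Fin n} (h1 : p.1.1 = i.succ) (h2 : p.1.2 = i.castSucc)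
    (a : Expo n) :
    (oprod A a * (toU (raise i) * toU (E p) ^ a p) * oprod B a) • vac lam =
      (oprod A a * (toU (E p) ^ a p * toU (raise i)) * oprod B a) • vac lam +
        ((a p : ℂ) * (simpleCoord lam i - colSum a i.castSucc + colSum a i.succ)) •
          mono (a - delta p) • vac lam := by
  have hbr : toU (raise i) * toU (E p) = toU (E p) * toU (raise i) + toU (coroot i).1 := by
    rw [toU_mul_toU, lie_raise_E_simple h1 h2]
  have hroot : (e p.1.1 - e p.1.2) (coroot i) = -2 := by
    have := (Fin.castSucc_lt_succ (i := i)).ne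
    rw [h1, h2, coroot, map_sub, LinearMap.sub_apply, LinearMap.sub_apply, e_eps, e_eps, e_eps,
      e_eps, if_neg this.symm, if_pos rfl, if_pos rfl, if_neg this]
    ring
  have hy : toU (coroot i).1 * toU (E p) = toU (E p) * toU (coroot i).1 +
      (-2 : ℂ) • toU (E p) := by
    rw [toU_mul_toU, lie_cartan_E, hroot, show toU ((-2 : ℂ) • E p) = (-2 : ℂ) • toU (E p) from
      map_smul _ _ _]
  have hH := cartan_smul_oprod (lam := lam) (coroot i) B a
  rw [h.weight_right h1 h2, ← mul_smul] at hH
  have hm := h.mono_sub_delta a 0 rfl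
  rw [add_zero, add_zero] at hm
  have hw : (oprod A a * (toU (E p) ^ (a p - 1) * toU (coroot i).1) * oprod B a) • vac lam =
      (lam (coroot i) + (colSum a i.succ - colSum a i.castSucc + a p)) •
        (oprod A a * toU (E p) ^ (a p - 1) * oprod B a) • vac lam := by
    rw [← mul_assoc, mul_assoc _ (toU (coroot i).1), mul_smul, hH, mul_smul _ (oprod B a),
      smul_comm]
  rw [commutator_pow_sl2 hbr hy, hm, simpleCoord_eq]
  simp only [mul_add, mul_sub, add_mul, sub_mul, mul_smul_comm, smul_mul_assoc, add_smul,
    sub_smul, smul_assoc] at hw ⊢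
  rw [hw, ← mul_assoc (oprod A a) _ (oprod B a)]
  generalize (oprod A a * toU (E p) ^ (a p - 1) * oprod B a) • vac lam = w
  generalize (oprod A a * (toU (E p) ^ a p * toU (raise i)) * oprod B a) • vac lam = w'
  module

theorem commutator (i : Fin n) (a : Expo n) :
    (oprod A a * (toU (raise i) * toU (E p) ^ a p) * oprod B a) • vac lam =
      (oprod A a * (toU (E p) ^ a p * toU (raise i)) * oprod B a) • vac lam +
        raiseCoeff lam i a p • mono (a - delta p + shift i p) • vac lam := by
  have hi : i.castSucc.1 + 1 = i.succ.1 := rfl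
  have hp := p.2
  by_cases h1 : p.1.1 = i.succ
  · by_cases h2 : p.1.2 = i.castSucc
    · rw [h.commutator_simple h1 h2, raiseCoeff, if_pos h1, if_pos h2, shift, dif_neg, dif_neg,
        add_zero]
      · rw [h1]; exact fun h => lt_irrefl _ h.2
      · rw [h2]; exact fun h => lt_irrefl _ h.2
    · have h3 : p.1.2 < i.castSucc := by rw [h1] at hp; omega
      rw [h.commutator_row h1 h3, raiseCoeff, if_pos h1, if_neg h2, shift, dif_pos ⟨h1, h3⟩,
        add_smul, smul_assoc]
  · by_cases h2 : p.1.2 = i.castSucc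
    · have h3 : i.succ < p.1.1 := by rw [h2] at hp; omega
      rw [h.commutator_col h2 h3, raiseCoeff, if_neg h1, if_pos h2, shift,
        dif_neg (fun h => h1 h.1), dif_pos ⟨h2, h3⟩, add_smul, smul_assoc]
    · rw [raiseCoeff, if_neg h1, if_neg h2, zero_smul, add_zero,
        ((commute_toU (lie_raise_E_of_ne h1 h2)).pow_right _).eq]

end SplitAt

theorem raise_smul_mono (i : Fin n) (a : Expo n) :
    toU (raise i) • mono a • vac lam =
      ∑ p, raiseCoeff lam i a p • mono (a - delta p + shift i p) • vac lam := by
  -- `A` holds the factors already passed; once `B` is empty the root vector meets the highest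
  -- weight vector and dies.
  have key : ∀ B A : List (NegIdx n), A ++ B = negList n →
      (oprod A a * toU (raise i) * oprod B a) • vac lam =
        (B.map fun p => raiseCoeff lam i a p • mono (a - delta p + shift i p) • vac lam).sum := by
    intro B
    induction B with
    | nil =>
      intro A _
      rw [oprod_nil, mul_one, mul_smul, raise_smul_vac, smul_zero]
      rfl
    | cons p B ih =>
      intro A hA
      have h := (SplitAt.mk hA).commutator (lam := lam) i a
      have h2 := ih (A ++ [p]) (by rw [List.append_assoc]; exact hA)
      rw [oprod_append, oprod_cons, oprod_nil, mul_one] at h2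
      rw [List.map_cons, List.sum_cons, ← h2, oprod_cons]
      refine Eq.trans ?_ (add_comm _ _)
      simp only [mul_assoc] at h ⊢
      exact h
  have h := key (negList n) [] rfl
  rw [oprod_nil, one_mul, sum_map_negList, ← mono_eq_oprod, mul_smul] at h
  exact h

end Action

end

section

variable {n : ℕ}

/-! ### Telescoping sums of simple roots -/

section Telescoping

theorem sum_telescope {M : Type*} [AddCommGroup M] (f : Fin (n + 1) → M) {k l : Fin (n + 1)}
    (h : k ≤ l) :
    ∑ j : Fin n with k ≤ j.castSucc ∧ j.castSucc < l, (f j.castSucc - f j.succ) = f k - f l := by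
  induction l using Fin.induction with
  | zero =>
    obtain rfl : k = 0 := le_antisymm h (Fin.zero_le _)
    simp
  | succ i ih =>
    rcases h.eq_or_lt with rfl | h
    · rw [sub_self]
      refine Finset.sum_eq_zero fun j hj => ?_
      have := (Finset.mem_filter.1 hj).2
      exact absurd (this.1.trans_lt this.2) (lt_irrefl _)
    · have hk : k ≤ i.castSucc := Fin.le_castSucc_iff.2 h
      have h1 : ∀ j : Fin n, (if k ≤ j.castSucc ∧ j.castSucc < i.succ then
          (f j.castSucc - f j.succ) else 0) =
          (if k ≤ j.castSucc ∧ j.castSucc < i.castSucc then (f j.castSucc - f j.succ) else 0) +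
          if j = i then (f j.castSucc - f j.succ) else 0 := fun j => by
        rcases lt_trichotomy j i with hj | rfl | hj
        · simp [hj.ne, hj, hj.le, Fin.castSucc_lt_succ_iff]
        · simp [hk]
        · simp [hj.ne', hj.not_gt, hj.not_ge, Fin.castSucc_lt_succ_iff]
      rw [Finset.sum_filter] at ih ⊢
      simp only [h1]
      rw [Finset.sum_add_distrib, ih hk]
      simp

/-- The coordinates of `lam + ρ`. -/
def coord (lam : Weight n) (x : Fin (n + 1)) : ℂ := (lam + rho n) (eps x)

theorem simpleCoord_eq_sub (lam : Weight n) (i : Fin n) :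
    simpleCoord lam i = coord lam i.castSucc - coord lam i.succ := by
  rw [simpleCoord, form_sub_e]; rfl

theorem u_eq (lam : Weight n) {k : Fin (n + 1)} {i : Fin n} (h : k ≤ i.castSucc) :
    u lam k i = coord lam k - coord lam i.succ := by
  rw [← sum_telescope (coord lam) (h.trans Fin.castSucc_lt_succ.le), u]
  simp only [simpleCoord_eq_sub, Fin.castSucc_lt_succ_iff]

end Telescoping

/-! ### Flow statistics and the coefficients -/

section Statistics

/-- The total exponent of a row. -/
def rowSum (a : Expo n) (x : Fin (n + 1)) : ℕ := ∑ p : NegIdx n with p.1.1 = x, a p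

/-- The total exponent of the pairs that pass strictly passSum a node. -/
def passSum (a : Expo n) (x : Fin (n + 1)) : ℕ := ∑ p : NegIdx n with p.1.2 < x ∧ x < p.1.1, a p

theorem r_eq_passSum (a : Expo n) (j : Fin n) : r a j = passSum a j.succ := rfl

theorem colSum_add_passSum (a : Expo n) (x : Fin (n + 1)) :
    colSum a x + passSum a x = ∑ p : NegIdx n with p.1.2 ≤ x ∧ ¬ p.1.1 ≤ x, a p := by
  simp only [colSum, passSum, Finset.sum_filter]
  rw [← Finset.sum_add_distrib]
  refine Finset.sum_congr rfl fun p _ => ?_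
  have := p.2
  split_ifs <;> first | rfl | omega

theorem rowSum_add_passSum (a : Expo n) (x : Fin (n + 1)) :
    rowSum a x + passSum a x = ∑ p : NegIdx n with p.1.2 < x ∧ ¬ p.1.1 < x, a p := by
  simp only [rowSum, passSum, Finset.sum_filter]
  rw [← Finset.sum_add_distrib]
  refine Finset.sum_congr rfl fun p _ => ?_
  have := p.2
  split_ifs <;> first | rfl | omega

/-- An arrow over i+1 also crosses the cut after i. Used to obtain r_i < m. -/
theorem passSum_succ_le (a : Expo n) (i : Fin n) :
    passSum a i.succ ≤ colSum a i.castSucc + passSum a i.castSucc := by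
  rw [colSum_add_passSum, passSum]
  refine Finset.sum_le_sum_of_subset fun p hp => ?_
  simp only [Finset.mem_filter, Finset.mem_univ, true_and] at hp ⊢
  have hi : i.castSucc.1 + 1 = i.succ.1 := rfl
  omega

theorem sum_add_delta (P : NegIdx n → Prop) [DecidablePred P] (a : Expo n) (p : NegIdx n) :
    ∑ q with P q, (a + delta p) q = (∑ q with P q, a q) + if P p then 1 else 0 := by
  simp only [Pi.add_apply, Finset.sum_add_distrib, delta, Finset.sum_pi_single', Finset.mem_filter,
    Finset.mem_univ, true_and]

theorem r_add_delta (a : Expo n) (p : NegIdx n) (j : Fin n) :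
    r (a + delta p) j = r a j + if p.1.2 < j.succ ∧ j.succ < p.1.1 then 1 else 0 :=
  sum_add_delta (fun p => p.1.2 < j.succ ∧ j.succ < p.1.1) a p

theorem colSum_add_delta (a : Expo n) (p : NegIdx n) (x : Fin (n + 1)) :
    colSum (a + delta p) x = colSum a x + if p.1.2 = x then 1 else 0 :=
  sum_add_delta (fun p => p.1.2 = x) a p

/-- The product of the factorials of the exponents. -/
def prodFact (a : Expo n) : ℂ := ∏ p : NegIdx n, ((a p)! : ℂ)

theorem prodFact_ne_zero (a : Expo n) : prodFact a ≠ 0 :=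
  Finset.prod_ne_zero_iff.2 fun _ _ => Nat.cast_ne_zero.2 (Nat.factorial_ne_zero _)

theorem prodFact_add_delta (a : Expo n) (p : NegIdx n) :
    prodFact (a + delta p) = (a p + 1) * prodFact a := by
  rw [prodFact, prodFact, ← Finset.mul_prod_erase _ _ (Finset.mem_univ p),
    ← Finset.mul_prod_erase _ _ (Finset.mem_univ p), Pi.add_apply, delta_self,
    Nat.factorial_succ, Nat.cast_mul, mul_assoc, Nat.cast_add_one]
  congr 2
  refine Finset.prod_congr rfl fun q hq => ?_
  rw [Pi.add_apply, delta_of_ne (Finset.ne_of_mem_erase hq), add_zero]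

/-- The numerator of the coefficients. -/
def numer (lam : Weight n) (k l : Fin (n + 1)) (m : ℕ) (s : Fin n → ℕ) : ℂ :=
  ∏ i : Fin n with k ≤ i.castSucc ∧ i.castSucc < l,
    (descPochhammer ℂ (s i)).eval (u lam k i) * ((m - s i)! : ℂ)

theorem coeff_eq (lam : Weight n) (k l : Fin (n + 1)) (m : ℕ) (a : Expo n) :
    coeff lam k l m a = numer lam k l m (r a) / prodFact a := rfl

/-- Only the j-th factor changes, by (u-s)/(m-s). The bound s_j < m keeps the truncated subtraction
in the factorial honest. `P` is abstract because the bumped index appears both as i and as the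
predecessor of i. -/
theorem numer_bump (lam : Weight n) {k l : Fin (n + 1)} {m : ℕ} (s : Fin n → ℕ) {j : Fin n}
    (h1 : k ≤ j.castSucc) (h2 : j.castSucc < l) (hs : s j < m) (P : Fin n → Prop)
    [DecidablePred P] (hP : ∀ i, P i ↔ i = j) :
    numer lam k l m (fun i => s i + if P i then 1 else 0) * (m - s j) =
      numer lam k l m s * (u lam k j - s j) := by
  have hj : j ∈ Finset.univ.filter fun i : Fin n => k ≤ i.castSucc ∧ i.castSucc < l := by
    simp [h1, h2]
  rw [numer, numer, ← Finset.mul_prod_erase _ _ hj, ← Finset.mul_prod_erase _ _ hj,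
    if_pos ((hP j).2 rfl)]
  have he : ∀ i ∈ (Finset.univ.filter fun i : Fin n => k ≤ i.castSucc ∧ i.castSucc < l).erase j,
      (descPochhammer ℂ (s i + if P i then 1 else 0)).eval (u lam k i) *
        ((m - (s i + if P i then 1 else 0))! : ℂ) =
      (descPochhammer ℂ (s i)).eval (u lam k i) * ((m - s i)! : ℂ) := fun i hi => by
    rw [if_neg fun h => Finset.ne_of_mem_erase hi ((hP i).1 h), add_zero]
  rw [Finset.prod_congr rfl he, descPochhammer_succ_eval]
  obtain ⟨d, hd⟩ := Nat.exists_eq_add_of_lt hs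
  rw [show m - (s j + 1) = d by omega, show m - s j = d + 1 by omega, Nat.factorial_succ, hd]
  push_cast
  ring

end Statistics

/-! ### Flow conservation and the cancellation identity -/

section Cancellation

variable {lam : Weight n} {k l : Fin (n + 1)} {m : ℕ} {i : Fin n} {b : Expo n}

theorem wt_lower_of_eq (hb : wt b = (m : ℂ) • (e l - e k) + (e i.castSucc - e i.succ))
    (S : Fin (n + 1) → Prop) [DecidablePred S] (hS : ∀ i j, i ≤ j → S j → S i) :
    ((∑ p : NegIdx n with S p.1.2 ∧ ¬ S p.1.1, b p : ℕ) : ℂ) =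
      m * ((if S k then 1 else 0) - (if S l then 1 else 0)) +
        ((if S i.succ then 1 else 0) - (if S i.castSucc then 1 else 0)) := by
  have h := wt_lower b S hS
  rw [hb, LinearMap.add_apply, LinearMap.smul_apply, sub_coweight, sub_coweight, smul_eq_mul] at h
  rw [← neg_eq_iff_eq_neg.2 h]
  ring

/-- b carries m units from k to l, less one unit from i to i+1. If the cut after i did not separate
k from l, the number of arrows across it would be -1. -/
theorem flow_right (hb : wt b = (m : ℂ) • (e l - e k) + (e i.castSucc - e i.succ)) (hkl : k < l) :
    k ≤ i.castSucc ∧ i.castSucc < l ∧ colSum b i.castSucc + passSum b i.castSucc + 1 = m := by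
  have h := wt_lower_of_eq hb (· ≤ i.castSucc) fun _ _ h h' => h.trans h'
  rw [← colSum_add_passSum, if_pos le_rfl, if_neg (not_le.2 Fin.castSucc_lt_succ)] at h
  by_cases h1 : k ≤ i.castSucc
  · by_cases h2 : l ≤ i.castSucc
    · rw [if_pos h1, if_pos h2] at h
      have h' : ((colSum b i.castSucc + passSum b i.castSucc + 1 : ℕ) : ℂ) = ((0 : ℕ) : ℂ) := by
        push_cast at h ⊢; rw [h]; ring
      exact absurd (Nat.cast_injective h') (by omega)
    · refine ⟨h1, not_le.1 h2, Nat.cast_injective (R := ℂ) ?_⟩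
      rw [if_pos h1, if_neg h2] at h
      push_cast at h ⊢; rw [h]; ring
  · rw [if_neg h1, if_neg fun h2 => h1 (hkl.le.trans h2)] at h
    have h' : ((colSum b i.castSucc + passSum b i.castSucc + 1 : ℕ) : ℂ) = ((0 : ℕ) : ℂ) := by
      push_cast at h ⊢; rw [h]; ring
    exact absurd (Nat.cast_injective h') (by omega)

theorem flow_left (hb : wt b = (m : ℂ) • (e l - e k) + (e i.castSucc - e i.succ))
    (hl : i.castSucc < l) :
    rowSum b i.castSucc + passSum b i.castSucc = if k < i.castSucc then m else 0 := by
  have h := wt_lower_of_eq hb (· < i.castSucc) fun _ _ h h' => h.trans_lt h'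
  rw [← rowSum_add_passSum, if_neg (lt_irrefl _), if_neg (not_lt.2 Fin.castSucc_lt_succ.le),
    if_neg (not_lt.2 hl.le)] at h
  refine Nat.cast_injective (R := ℂ) ?_
  rw [h]
  split_ifs <;> simp

theorem flow_right_succ (hb : wt b = (m : ℂ) • (e l - e k) + (e i.castSucc - e i.succ))
    (hk : k ≤ i.castSucc) :
    colSum b i.succ + passSum b i.succ = if i.succ < l then m else 0 := by
  have h := wt_lower_of_eq hb (· ≤ i.succ) fun _ _ h h' => h.trans h'
  rw [← colSum_add_passSum, if_pos le_rfl, if_pos Fin.castSucc_lt_succ.le,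
    if_pos (hk.trans Fin.castSucc_lt_succ.le)] at h
  refine Nat.cast_injective (R := ℂ) ?_
  rw [h]
  by_cases h1 : l ≤ i.succ
  · simp [h1, not_lt.2 h1]
  · simp [h1, not_le.1 h1]

/-- With c the coordinates of λ+ρ, the row and column terms become the common numerator times c_k -
c_i - pass_i and c_k - c_{i+1} - m + col_{i+1}. Adding the middle term leaves m - 1 - col_i -
pass_i, which is zero by conservation across the cut after i. -/
theorem cancellation (hkl : k < l) (hm : form (lam + rho n) (e k - e l) = (m : ℂ))
    (hb : wt b = (m : ℂ) • (e l - e k) + (e i.castSucc - e i.succ)) :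
    numer lam k l m (fun j => r b j + if j.succ = i.castSucc then 1 else 0) *
        rowSum b i.castSucc +
      numer lam k l m (r b) * (simpleCoord lam i - (colSum b i.castSucc + 1) + colSum b i.succ) -
      numer lam k l m (fun j => r b j + if j = i then 1 else 0) * colSum b i.succ = 0 := by
  obtain ⟨hk, hl, h1⟩ := flow_right hb hkl
  have h2 := flow_left hb hl
  have h3 := flow_right_succ hb hk
  have h4 := passSum_succ_le b i
  have hm' : coord lam k - coord lam l = m := by rw [← hm, form_sub_e]; rfl
  have hrow : numer lam k l m (fun j => r b j + if j.succ = i.castSucc then 1 else 0) *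
      rowSum b i.castSucc =
      numer lam k l m (r b) * (coord lam k - coord lam i.castSucc - passSum b i.castSucc) := by
    rcases hk.eq_or_lt with hk' | hk'
    -- Boundary k = i: nothing enters or passes over i, and the factor c_k - c_i vanishes as well.
    · rw [if_neg hk'.not_lt] at h2
      obtain ⟨h5, h6⟩ := Nat.add_eq_zero_iff.1 h2
      rw [h5, h6, hk']
      simp
    · rw [if_pos hk'] at h2
      obtain ⟨j, hj⟩ := Fin.exists_succ_eq.2 ((Fin.zero_le k).trans_lt hk').ne'
      have hkj : k ≤ j.castSucc := Fin.le_castSucc_iff.2 (hj ▸ hk')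
      have hjl : j.castSucc < l := (Fin.castSucc_lt_succ.trans_eq hj).trans hl
      have hrj : r b j = passSum b i.castSucc := by rw [r_eq_passSum, hj]
      have h := numer_bump (m := m) lam (r b) hkj hjl (by rw [hrj]; omega)
        (fun j' => j'.succ = i.castSucc) fun j' => by rw [← hj, Fin.succ_inj]
      rw [u_eq lam hkj, hj, hrj] at h
      rw [← h]
      congr 1
      rw [← h2]
      push_cast; ring
  have hcol : numer lam k l m (fun j => r b j + if j = i then 1 else 0) * colSum b i.succ =
      numer lam k l m (r b) * (coord lam k - coord lam i.succ - m + colSum b i.succ) := by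
    by_cases hl' : i.succ < l
    · rw [if_pos hl'] at h3
      have hri : r b i = passSum b i.succ := r_eq_passSum b i
      have h := numer_bump (m := m) lam (r b) hk hl (by rw [hri]; omega)
        (fun j => j = i) fun _ => Iff.rfl
      rw [u_eq lam hk, hri] at h
      have h5 : (colSum b i.succ : ℂ) = m - passSum b i.succ := by rw [← h3]; push_cast; ring
      rw [h5, h]
      ring
    -- Boundary l = i+1: nothing leaves l, and the right-hand factor vanishes exactly because c_k -
    -- c_l = m.
    · rw [if_neg hl'] at h3
      have h5 : l = i.succ := le_antisymm (not_lt.1 hl') (Fin.castSucc_lt_iff_succ_le.1 hl)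
      rw [(Nat.add_eq_zero_iff.1 h3).1, ← h5, hm']
      simp
  have h6 : (m : ℂ) = colSum b i.castSucc + passSum b i.castSucc + 1 := by rw [← h1]; push_cast; ring
  rw [hrow, hcol, simpleCoord_eq_sub, h6]
  ring

end Cancellation

end

section

variable {n : ℕ}

/-! ### Collecting the coefficient of a fixed monomial -/

section Reindexing

theorem delta_le_iff {p : NegIdx n} {b : Expo n} : delta p ≤ b ↔ b p ≠ 0 := by
  constructor
  · intro h
    have := h p
    rw [delta_self] at this
    exact Nat.one_le_iff_ne_zero.1 this
  · intro h q
    by_cases hq : q = p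
    · subst hq; rw [delta_self]; exact Nat.one_le_iff_ne_zero.2 h
    · rw [delta_of_ne hq]; exact Nat.zero_le _

open scoped Classical in
/-- The contribution of `E_p` to the coefficient of `E^b` in the image of the singular vector. -/
def pull (lam : Weight n) (k l : Fin (n + 1)) (m : ℕ) (i : Fin n) (p : NegIdx n) (b : Expo n) : ℂ :=
  if shift i p ≤ b then
    coeff lam k l m (b - shift i p + delta p) * raiseCoeff lam i (b - shift i p + delta p) p
  else 0

variable {lam : Weight n} {k l : Fin (n + 1)} {m : ℕ} {i : Fin n} {b : Expo n}

/-- Trading an arrow s of b for p multiplies the product of factorials by a_p / b_s, where a_p is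
the new exponent of p. The a_p cancels against the one in the action, leaving b_s. `P` marks the
node that p passes over but s does not. -/
theorem pull_of_shift {p s : NegIdx n} (hs : shift i p = delta s)
    (z : ℂ) (hz : ∀ a, raiseCoeff lam i a p = z * a p) (P : Fin n → Prop) [DecidablePred P]
    (hP : ∀ j, ((if p.1.2 < j.succ ∧ j.succ < p.1.1 then 1 else 0 : ℕ)) =
      (if s.1.2 < j.succ ∧ j.succ < s.1.1 then 1 else 0) + if P j then 1 else 0) :
    pull lam k l m i p b =
      z * numer lam k l m (fun j => r b j + if P j then 1 else 0) / prodFact b * b s := by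
  rw [pull, hs]
  split_ifs with h
  · obtain ⟨c, rfl⟩ : ∃ c, b = c + delta s := ⟨b - delta s, (tsub_add_cancel_of_le h).symm⟩
    rw [add_tsub_cancel_right, coeff_eq, hz, prodFact_add_delta, prodFact_add_delta, Pi.add_apply,
      Pi.add_apply, delta_self, delta_self]
    have h1 : r (c + delta p) = fun j => r (c + delta s) j + if P j then 1 else 0 := by
      funext j
      rw [r_add_delta, r_add_delta, hP, add_assoc]
    have h2 := prodFact_ne_zero c
    have h3 : (c p : ℂ) + 1 ≠ 0 := Nat.cast_add_one_ne_zero _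
    have h4 : (c s : ℂ) + 1 ≠ 0 := Nat.cast_add_one_ne_zero _
    rw [h1]
    push_cast
    field_simp
  · rw [delta_le_iff, not_not] at h
    rw [h, Nat.cast_zero, mul_zero]

theorem pull_row {p : NegIdx n} (h1 : p.1.1 = i.succ) (h2 : p.1.2 < i.castSucc) :
    pull lam k l m i p b =
      1 * numer lam k l m (fun j => r b j + if j.succ = i.castSucc then 1 else 0) / prodFact b *
        b ⟨(i.castSucc, p.1.2), h2⟩ := by
  have hi : i.castSucc.1 + 1 = i.succ.1 := rfl
  refine pull_of_shift ?_ 1 (fun a => ?_) _ fun j => ?_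
  · rw [shift, dif_pos ⟨h1, h2⟩]
  · rw [raiseCoeff, if_pos h1, if_neg h2.ne, one_mul]
  · dsimp only
    rw [h1]
    split_ifs <;> first | rfl | omega

theorem pull_col {p : NegIdx n} (h1 : p.1.2 = i.castSucc) (h2 : i.succ < p.1.1) :
    pull lam k l m i p b =
      -1 * numer lam k l m (fun j => r b j + if j = i then 1 else 0) / prodFact b *
        b ⟨(p.1.1, i.succ), h2⟩ := by
  have hi : i.castSucc.1 + 1 = i.succ.1 := rfl
  refine pull_of_shift ?_ (-1) (fun a => ?_) _ fun j => ?_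
  · rw [shift, dif_neg (fun h => h2.ne' h.1), dif_pos ⟨h1, h2⟩]
  · rw [raiseCoeff, if_neg h2.ne', if_pos h1, neg_one_mul]
  · dsimp only
    have hj : j = i ↔ j.succ = i.succ := Fin.succ_inj.symm
    simp only [h1, hj]
    split_ifs <;> first | rfl | omega

theorem pull_simple {p : NegIdx n} (h1 : p.1.1 = i.succ) (h2 : p.1.2 = i.castSucc) :
    pull lam k l m i p b = numer lam k l m (r b) *
      (simpleCoord lam i - (colSum b i.castSucc + 1) + colSum b i.succ) / prodFact b := by
  have hs : shift i p = 0 := by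
    rw [shift, dif_neg (fun h => h.2.ne h2), dif_neg (fun h => h.2.ne' h1)]
  have hi : i.castSucc.1 + 1 = i.succ.1 := rfl
  have hr : r (b + delta p) = r b := by
    funext j
    rw [r_add_delta, h1, h2, if_neg (by omega), add_zero]
  rw [pull, hs, if_pos zero_le, tsub_zero, coeff_eq, prodFact_add_delta, hr, raiseCoeff,
    if_pos h1, if_pos h2, colSum_add_delta, colSum_add_delta, if_pos h2,
    if_neg (by rw [h2]; exact Fin.castSucc_lt_succ.ne), Pi.add_apply, delta_self]
  have h3 := prodFact_ne_zero b
  have h4 : (b p : ℂ) + 1 ≠ 0 := Nat.cast_add_one_ne_zero _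
  push_cast
  field_simp
  ring

theorem pull_inactive {p : NegIdx n} (h1 : p.1.1 ≠ i.succ) (h2 : p.1.2 ≠ i.castSucc) :
    pull lam k l m i p b = 0 := by
  rw [pull, raiseCoeff, if_neg h1, if_neg h2, mul_zero, ite_self]

/-- Within each of the two families the numerator is constant, so the sum over p amounts to a row or
column sum of b. -/
theorem sum_pull (hkl : k < l) (hm : form (lam + rho n) (e k - e l) = (m : ℂ))
    (hb : wt b = (m : ℂ) • (e l - e k) + (e i.castSucc - e i.succ)) :
    ∑ p, pull lam k l m i p b = 0 := by
  have hi : i.castSucc.1 + 1 = i.succ.1 := rfl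
  let p₀ : NegIdx n := ⟨(i.succ, i.castSucc), Fin.castSucc_lt_succ⟩
  have hsplit : ∀ p : NegIdx n, pull lam k l m i p b =
      (if p.1.1 = i.succ ∧ p.1.2 < i.castSucc then pull lam k l m i p b else 0) +
      (if p = p₀ then pull lam k l m i p b else 0) +
      (if p.1.2 = i.castSucc ∧ i.succ < p.1.1 then pull lam k l m i p b else 0) := fun p => by
    have hp := p.2
    have hp0 : p = p₀ ↔ p.1.1 = i.succ ∧ p.1.2 = i.castSucc := by
      rw [Subtype.ext_iff, Prod.ext_iff]
    simp only [hp0]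
    by_cases h1 : p.1.1 = i.succ
    · rw [h1] at hp
      by_cases h2 : p.1.2 = i.castSucc
      · simp [h1, h2]
      · have h3 : p.1.2 < i.castSucc := by omega
        simp [h1, h2, h3]
    · by_cases h2 : p.1.2 = i.castSucc
      · have h3 : i.succ < p.1.1 := by omega
        simp [h1, h2, h3]
      · rw [pull_inactive h1 h2]; simp
  have hrow : ∑ p : NegIdx n with p.1.1 = i.succ ∧ p.1.2 < i.castSucc, pull lam k l m i p b =
      1 * numer lam k l m (fun j => r b j + if j.succ = i.castSucc then 1 else 0) / prodFact b *
        rowSum b i.castSucc := by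
    rw [rowSum, Nat.cast_sum, Finset.mul_sum]
    refine Finset.sum_bij (fun p hp => ⟨(i.castSucc, p.1.2), (Finset.mem_filter.1 hp).2.2⟩)
      (fun p hp => by simp) (fun p hp q hq hpq => ?_) (fun s hs => ?_) fun p hp => ?_
    · have h1 := (Finset.mem_filter.1 hp).2.1.trans (Finset.mem_filter.1 hq).2.1.symm
      have h2 := congrArg (fun q : NegIdx n => q.1.2) hpq
      exact Subtype.ext (Prod.ext h1 h2)
    · have h1 : s.1.1 = i.castSucc := (Finset.mem_filter.1 hs).2
      have h2 : s.1.2 < i.castSucc := h1 ▸ s.2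
      exact ⟨⟨(i.succ, s.1.2), h2.trans Fin.castSucc_lt_succ⟩, by simp [h2],
        Subtype.ext (Prod.ext h1.symm rfl)⟩
    · exact pull_row (Finset.mem_filter.1 hp).2.1 (Finset.mem_filter.1 hp).2.2
  have hcol : ∑ p : NegIdx n with p.1.2 = i.castSucc ∧ i.succ < p.1.1, pull lam k l m i p b =
      -1 * numer lam k l m (fun j => r b j + if j = i then 1 else 0) / prodFact b *
        colSum b i.succ := by
    rw [colSum, Nat.cast_sum, Finset.mul_sum]
    refine Finset.sum_bij (fun p hp => ⟨(p.1.1, i.succ), (Finset.mem_filter.1 hp).2.2⟩)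
      (fun p hp => by simp) (fun p hp q hq hpq => ?_) (fun s hs => ?_) fun p hp => ?_
    · have h1 := (Finset.mem_filter.1 hp).2.1.trans (Finset.mem_filter.1 hq).2.1.symm
      have h2 := congrArg (fun q : NegIdx n => q.1.1) hpq
      exact Subtype.ext (Prod.ext h2 h1)
    · have h1 : s.1.2 = i.succ := (Finset.mem_filter.1 hs).2
      have h2 : i.succ < s.1.1 := h1 ▸ s.2
      exact ⟨⟨(s.1.1, i.castSucc), Fin.castSucc_lt_succ.trans h2⟩, by simp [h2],
        Subtype.ext (Prod.ext rfl h1.symm)⟩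
    · exact pull_col (Finset.mem_filter.1 hp).2.1 (Finset.mem_filter.1 hp).2.2
  rw [Finset.sum_congr rfl fun p _ => hsplit p, Finset.sum_add_distrib, Finset.sum_add_distrib,
    ← Finset.sum_filter, ← Finset.sum_filter, ← Finset.sum_filter, hrow, hcol,
    Finset.filter_eq' Finset.univ p₀, if_pos (Finset.mem_univ _), Finset.sum_singleton,
    pull_simple rfl rfl]
  have h := cancellation hkl hm hb
  have h3 := prodFact_ne_zero b
  field_simp
  linear_combination h

theorem wt_add (a b : Expo n) : wt (a + b) = wt a + wt b := by
  simp only [wt, Pi.add_apply, Nat.cast_add, add_smul, Finset.sum_add_distrib]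

theorem wt_delta (p : NegIdx n) : wt (delta p) = e p.1.1 - e p.1.2 := by
  rw [wt, Finset.sum_eq_single p]
  · rw [delta_self, Nat.cast_one, one_smul]
  · intro q _ hq
    rw [delta_of_ne hq, Nat.cast_zero, zero_smul]
  · simp

theorem wt_shift {p : NegIdx n} (h : p.1.1 = i.succ ∨ p.1.2 = i.castSucc) :
    wt (shift i p) = wt (delta p) + (e i.castSucc - e i.succ) := by
  have hi : i.castSucc.1 + 1 = i.succ.1 := rfl
  have hp := p.2
  rw [wt_delta, shift]
  split_ifs with h1 h2
  · rw [wt_delta, h1.1]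
    dsimp only
    abel
  · rw [wt_delta, h2.1]
    dsimp only
    abel
  · have h3 : p.1.1 = i.succ ∧ p.1.2 = i.castSucc := by
      rcases h with h | h
      · rw [h] at hp
        refine ⟨h, ?_⟩
        have : ¬ p.1.2 < i.castSucc := fun h' => h1 ⟨h, h'⟩
        omega
      · rw [h] at hp
        refine ⟨?_, h⟩
        have : ¬ i.succ < p.1.1 := fun h' => h2 ⟨h, h'⟩
        omega
    rw [h3.1, h3.2]
    simp [wt]

theorem raiseCoeff_eq_zero {a : Expo n} {p : NegIdx n} (h : a p = 0) :
    raiseCoeff lam i a p = 0 := by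
  rw [raiseCoeff, h]
  simp

/-- The set of exponents of a given weight. -/
def wtFinset (μ : Weight n) : Finset (Expo n) := (finite_wt_eq μ).toFinset

theorem mem_wtFinset {μ : Weight n} {a : Expo n} : a ∈ wtFinset μ ↔ wt a = μ := by
  simp [wtFinset]

theorem reindex (p : NegIdx n) (μ : Weight n) :
    ∑ a ∈ wtFinset μ, (coeff lam k l m a * raiseCoeff lam i a p) •
        mono (a - delta p + shift i p) • vac lam =
      ∑ b ∈ wtFinset (μ + (e i.castSucc - e i.succ)), pull lam k l m i p b • mono b • vac lam := by
  classical
  by_cases h : p.1.1 = i.succ ∨ p.1.2 = i.castSucc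
  -- Terms where a truncated subtraction would lose information have coefficient zero; on the rest
  -- the two shifts are mutually inverse.
  · have h1 : ∀ a ∈ wtFinset μ, (coeff lam k l m a * raiseCoeff lam i a p) •
        mono (a - delta p + shift i p) • vac lam ≠ 0 → delta p ≤ a := fun a _ ha => by
      rw [delta_le_iff]
      intro h0
      rw [raiseCoeff_eq_zero h0, mul_zero, zero_smul] at ha
      exact ha rfl
    have h2 : ∀ b ∈ wtFinset (μ + (e i.castSucc - e i.succ)),
        pull lam k l m i p b • mono b • vac lam ≠ 0 → shift i p ≤ b := fun b _ hb => by
      by_contra h0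
      rw [pull, if_neg h0, zero_smul] at hb
      exact hb rfl
    rw [← Finset.sum_filter_of_ne h1, ← Finset.sum_filter_of_ne h2]
    refine Finset.sum_nbij' (fun a => a - delta p + shift i p) (fun b => b - shift i p + delta p)
      (fun a ha => ?_) (fun b hb => ?_) (fun a ha => ?_) (fun b hb => ?_) fun a ha => ?_
    · rw [Finset.mem_filter, mem_wtFinset] at ha ⊢
      refine ⟨?_, le_add_self⟩
      rw [wt_add, wt_shift h, ← ha.1]
      conv_rhs => rw [← tsub_add_cancel_of_le ha.2, wt_add]
      rw [add_assoc]
    · rw [Finset.mem_filter, mem_wtFinset] at hb ⊢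
      refine ⟨?_, le_add_self⟩
      have h3 := hb.1
      rw [← tsub_add_cancel_of_le hb.2, wt_add, wt_shift h, ← add_assoc] at h3
      rw [wt_add]
      exact add_right_cancel h3
    · rw [Finset.mem_filter] at ha
      rw [add_tsub_cancel_right, tsub_add_cancel_of_le ha.2]
    · rw [Finset.mem_filter] at hb
      rw [add_tsub_cancel_right, tsub_add_cancel_of_le hb.2]
    · rw [Finset.mem_filter] at ha
      rw [pull, if_pos le_add_self, add_tsub_cancel_right, tsub_add_cancel_of_le ha.2]
  · rw [not_or] at h
    rw [Finset.sum_eq_zero, Finset.sum_eq_zero]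
    · intro b _
      rw [pull_inactive h.1 h.2, zero_smul]
    · intro a _
      rw [raiseCoeff, if_neg h.1, if_neg h.2, mul_zero, zero_smul]

/-- The vector of the theorem. -/
def singularVector (lam : Weight n) (k l : Fin (n + 1)) (m : ℕ) : Verma lam :=
  ∑ a ∈ wtFinset ((m : ℂ) • (e l - e k)), coeff lam k l m a • mono a • vac lam

theorem raise_smul_singularVector (hkl : k < l)
    (hm : form (lam + rho n) (e k - e l) = (m : ℂ)) (i : Fin n) :
    toU (raise i) • singularVector lam k l m = 0 := by
  rw [singularVector, Finset.smul_sum]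
  have h : ∀ a : Expo n, toU (raise i) • coeff lam k l m a • mono a • vac lam =
      ∑ p, (coeff lam k l m a * raiseCoeff lam i a p) •
        mono (a - delta p + shift i p) • vac lam := fun a => by
    rw [smul_comm, raise_smul_mono, Finset.smul_sum]
    simp only [mul_smul]
  rw [Finset.sum_congr rfl fun a _ => h a, Finset.sum_comm,
    Finset.sum_congr rfl fun p _ => reindex p _, Finset.sum_comm]
  refine Finset.sum_eq_zero fun b hb => ?_
  rw [← Finset.sum_smul, sum_pull hkl hm (mem_wtFinset.1 hb), zero_smul]

end Reindexing

end

section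

variable {n : ℕ}

/-! ### Simple root vectors generate 𝔫 -/

section Nilradical

/-- A vector killed by the simple root vectors is killed by `𝔫`. -/
theorem nilradical_smul_eq_zero {V : Type*} [AddCommGroup V] [Module (U n) V] {v : V}
    (hv : ∀ i : Fin n, toU (raise i) • v = 0) {x : G n} (hx : x ∈ nilradical n) :
    toU x • v = 0 := by
  let K : AddSubgroup (G n) :=
    { carrier := {x | toU x • v = 0}
      add_mem' := fun {x y} (hx : toU x • v = 0) (hy : toU y • v = 0) => by
        change toU (x + y) • v = 0
        rw [show toU (x + y) = toU x + toU y from map_add _ x y, add_smul, hx, hy, add_zero]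
      zero_mem' := by
        change toU 0 • v = 0
        rw [show toU (0 : G n) = 0 from map_zero _, zero_smul]
      neg_mem' := fun {x} (hx : toU x • v = 0) => by
        change toU (-x) • v = 0
        rw [show toU (-x) = - toU x from map_neg _ x, neg_smul, hx, neg_zero] }
  have hlie : ∀ x y : G n, x ∈ K → y ∈ K → ⁅x, y⁆ ∈ K :=
    fun x y (hx : toU x • v = 0) (hy : toU y • v = 0) => by
      have h := congrArg (· • v) (toU_mul_toU x y)
      rw [mul_smul, hy, smul_zero, add_smul, mul_smul, hx, smul_zero, zero_add] at h
      exact h.symm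
  -- Induction on the column by [E_{p,i}, z E_{i,i+1}] = z E_{p,i+1}. The scalar z is carried along
  -- because `K` is only an additive subgroup.
  have hsingle : ∀ q p : Fin (n + 1), ∀ (h : p < q) (z : ℂ),
      LieAlgebra.SpecialLinear.single p q h.ne z ∈ K := by
    intro q
    induction q using Fin.induction with
    | zero => exact fun p h => absurd h (Fin.not_lt_zero p)
    | succ i ih =>
      intro p h z
      have hi : z • raise i ∈ K := by
        change toU (z • raise i) • v = 0
        rw [show toU (z • raise i) = z • toU (raise i) from map_smul _ z _,
          Algebra.smul_def, mul_smul, hv, smul_zero]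
      rcases (Fin.le_castSucc_iff.2 h).eq_or_lt with rfl | h'
      · have h2 : LieAlgebra.SpecialLinear.single i.castSucc i.succ h.ne z = z • raise i := by
          rw [raise, ← map_smul, smul_eq_mul, mul_one]
        rw [h2]
        exact hi
      · have h2 := hlie _ _ (ih p h' 1) hi
        have h3 : ⁅LieAlgebra.SpecialLinear.single p i.castSucc h'.ne (1 : ℂ), z • raise i⁆ =
            LieAlgebra.SpecialLinear.single p i.succ h.ne z := by
          apply Subtype.ext
          rw [val_lie]
          change Matrix.single _ _ _ * (z • Matrix.single _ _ _) -
            (z • Matrix.single _ _ _) * Matrix.single _ _ _ = Matrix.single _ _ _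
          rw [Matrix.mul_smul, Matrix.smul_mul, Matrix.single_mul_single_same,
            Matrix.single_mul_single_of_ne _ _ _ _ h.ne', smul_zero, sub_zero, Matrix.smul_single]
          simp
        rw [← h3]
        exact h2
  have hsum : x = ∑ p, ∑ q, if h : p < q then
      LieAlgebra.SpecialLinear.single p q h.ne (x.1 p q) else 0 := by
    apply Subtype.ext
    have hcoe : ∀ p q : Fin (n + 1), ((if h : p < q then
        LieAlgebra.SpecialLinear.single p q h.ne (x.1 p q) else 0 : G n) :
        Matrix (Fin (n + 1)) (Fin (n + 1)) ℂ) = Matrix.single p q (x.1 p q) := fun p q => by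
      split_ifs with h
      · rfl
      · rw [hx p q (not_lt.1 h), Matrix.single_zero]
        rfl
    rw [AddSubmonoidClass.coe_finsetSum]
    conv_lhs => rw [Matrix.matrix_eq_sum_single x.1]
    refine Finset.sum_congr rfl fun p _ => ?_
    rw [AddSubmonoidClass.coe_finsetSum]
    exact Finset.sum_congr rfl fun q _ => (hcoe p q).symm
  have hmem : x ∈ K := by
    rw [hsum]
    refine sum_mem fun p _ => sum_mem fun q _ => ?_
    split_ifs with h
    · exact hsingle q p h _
    · exact K.zero_mem
  exact hmem

end Nilradical

/-! ### Nonvanishing and weight of the vector -/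

section Nonvanishing

variable {lam : Weight n} {k l : Fin (n + 1)} {m : ℕ}

/-- The exponent supported on the simple roots between `k` and `l`. -/
def simpleExpo (k l : Fin (n + 1)) (m : ℕ) : Expo n := fun p =>
  if (p.1.2 : ℕ) + 1 = p.1.1 ∧ k ≤ p.1.2 ∧ p.1.2 < l then m else 0

theorem wt_simpleExpo (hkl : k < l) : wt (simpleExpo k l m) = (m : ℂ) • (e l - e k) := by
  have h : ∑ j : Fin n with k ≤ j.castSucc ∧ j.castSucc < l,
      (m : ℂ) • ((e j.succ : Weight n) - e j.castSucc) = wt (simpleExpo k l m) := by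
    refine Finset.sum_of_injOn (fun j => ⟨(j.succ, j.castSucc), Fin.castSucc_lt_succ⟩)
      (fun i _ j _ hij => ?_) (fun _ _ => Finset.mem_coe.2 (Finset.mem_univ _))
      (fun p _ hp => ?_) (fun j hj => ?_)
    · have h := congrArg (fun q : NegIdx n => q.1.1) hij
      exact Fin.succ_injective _ h
    · rw [simpleExpo, if_neg, Nat.cast_zero, zero_smul]
      rintro ⟨h1, h2⟩
      obtain ⟨⟨p1, p2⟩, h⟩ := p
      dsimp only at h1 h2
      have hn : p2.1 < n := by have := p1.2; omega
      have h3 : (⟨p2.1, hn⟩ : Fin n).castSucc = p2 := rfl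
      refine hp ⟨⟨p2.1, hn⟩, ?_, Subtype.ext (Prod.ext (Fin.ext h1) h3)⟩
      simpa [h3] using h2
    · have hj' := (Finset.mem_filter.1 hj).2
      rw [simpleExpo, if_pos ⟨rfl, hj'⟩]
  rw [← h, ← Finset.smul_sum]
  congr 1
  have h2 := sum_telescope (fun x => (e x : Weight n)) hkl.le
  rw [← neg_sub, ← h2, ← Finset.sum_neg_distrib]
  exact Finset.sum_congr rfl fun j _ => (neg_sub _ _).symm

/-- When all arrows have length 1, each cut is crossed by a single kind of arrow, so the weight
determines every multiplicity. -/
theorem eq_simpleExpo (hkl : k < l) {a : Expo n} (ha : wt a = (m : ℂ) • (e l - e k))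
    (h0 : ∀ p : NegIdx n, (p.1.2 : ℕ) + 1 ≠ p.1.1 → a p = 0) : a = simpleExpo k l m := by
  funext p
  rw [simpleExpo]
  by_cases hp : (p.1.2 : ℕ) + 1 = p.1.1
  · have h := wt_lower a (· ≤ p.1.2) fun _ _ h h' => h.trans h'
    rw [ha, LinearMap.smul_apply, sub_coweight, smul_eq_mul,
      Finset.sum_eq_single_of_mem p (by simp [p.2])] at h
    · refine Nat.cast_injective (R := ℂ) ?_
      rw [← neg_eq_iff_eq_neg.2 h]
      by_cases h1 : k ≤ p.1.2
      · by_cases h2 : l ≤ p.1.2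
        · simp [h1, h2, not_lt.2 h2]
        · simp [hp, h1, h2, not_le.1 h2]
      · have h2 : ¬ l ≤ p.1.2 := fun h2 => h1 (hkl.le.trans h2)
        simp [h1, h2]
    · intro q hq hqp
      refine h0 q fun h1 => hqp ?_
      have hq' := (Finset.mem_filter.1 hq).2
      exact Subtype.ext (Prod.ext (Fin.ext (by omega)) (Fin.ext (by omega)))
  · rw [h0 p hp, if_neg fun h => hp h.1]

/-- Arrows of length 1 pass over no node, so every r_i is 0 and the falling factorials, which could
vanish, are all 1. -/
theorem coeff_simpleExpo_ne_zero : coeff lam k l m (simpleExpo k l m) ≠ 0 := by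
  have hr : ∀ j, r (simpleExpo k l m) j = 0 := fun j => by
    refine Finset.sum_eq_zero fun p hp => ?_
    have hp := (Finset.mem_filter.1 hp).2
    rw [simpleExpo, if_neg]
    rintro ⟨h, -⟩
    omega
  rw [coeff_eq]
  refine div_ne_zero (Finset.prod_ne_zero_iff.2 fun j _ => ?_) (prodFact_ne_zero _)
  rw [hr, descPochhammer_zero, Polynomial.eval_one, one_mul]
  exact Nat.cast_ne_zero.2 (Nat.factorial_ne_zero _)

theorem singularVector_ne_zero (hkl : k < l) : singularVector lam k l m ≠ 0 := by
  obtain ⟨ψ, hψ1, hψ⟩ := exists_whittaker lam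
  have hpow : ∀ (p : NegIdx n) (w : Verma lam) (d : ℕ), ψ (toU (E p) ^ d • w) =
      (if (p.1.2 : ℕ) + 1 = p.1.1 then 1 else 0) ^ d * ψ w := by
    intro p w d
    induction d with
    | zero => simp
    | succ d ih => rw [pow_succ', mul_smul, hψ, ih, pow_succ', mul_assoc]
  have hprod : ∀ (a : Expo n) (L : List (NegIdx n)), ψ (oprod L a • vac lam) =
      (L.map fun p => (if (p.1.2 : ℕ) + 1 = p.1.1 then (1 : ℂ) else 0) ^ a p).prod := by
    intro a L
    induction L with
    | nil => rw [oprod_nil, one_smul, hψ1]; rfl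
    | cons p L ih => rw [oprod_cons, mul_smul, hpow, ih, List.map_cons, List.prod_cons]
  intro h
  have h1 := congrArg ψ h
  rw [singularVector, map_zero, map_sum,
    Finset.sum_eq_single_of_mem _ (mem_wtFinset.2 (wt_simpleExpo hkl)), map_smul, mono_eq_oprod,
    hprod, List.prod_eq_one] at h1
  · rw [smul_eq_mul, mul_one] at h1
    exact coeff_simpleExpo_ne_zero h1
  · intro x hx
    obtain ⟨p, -, rfl⟩ := List.mem_map.1 hx
    split_ifs with hp
    · exact one_pow _
    · rw [simpleExpo, if_neg fun h => hp h.1, pow_zero]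
  -- Any other exponent of this weight uses an arrow of length greater than 1, and that factor makes
  -- ψ vanish.
  · intro a ha hne
    have h2 : ∃ p : NegIdx n, (p.1.2 : ℕ) + 1 ≠ p.1.1 ∧ a p ≠ 0 := by
      by_contra hcon
      push Not at hcon
      exact hne (eq_simpleExpo hkl (mem_wtFinset.1 ha) hcon)
    obtain ⟨p, hp, hap⟩ := h2
    rw [map_smul, mono_eq_oprod, hprod, List.prod_eq_zero, smul_zero]
    refine List.mem_map.2 ⟨p, mem_negList p, ?_⟩
    rw [if_neg hp, zero_pow hap]

end Nonvanishing

theorem dotReflect_eq {lam : Weight n} {k l : Fin (n + 1)} {m : ℕ} (hkl : k < l)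
    (hm : form (lam + rho n) (e k - e l) = (m : ℂ)) :
    dotReflect (e k - e l) lam = lam + (m : ℂ) • (e l - e k) := by
  have h : form (e k - e l : Weight n) (e k - e l) = 2 := by
    rw [form_sub_e, LinearMap.sub_apply, LinearMap.sub_apply, e_eps, e_eps, e_eps, e_eps,
      if_pos rfl, if_pos rfl, if_neg hkl.ne, if_neg hkl.ne']
    ring
  have hc : check (e k - e l : Weight n) = e k - e l := by
    rw [check, h, div_self two_ne_zero, one_smul]
  rw [dotReflect, reflect, hc, hm]
  module

theorem isWeightVector_singularVector {lam : Weight n} {k l : Fin (n + 1)} {m : ℕ} (hkl : k < l)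
    (hm : form (lam + rho n) (e k - e l) = (m : ℂ)) :
    IsWeightVector (dotReflect (e k - e l) lam) (singularVector lam k l m) := by
  refine ⟨singularVector_ne_zero hkl, fun H => ?_⟩
  rw [singularVector, Finset.smul_sum, Finset.smul_sum]
  refine Finset.sum_congr rfl fun a ha => ?_
  rw [smul_comm, cartan_smul_mono, mem_wtFinset.1 ha, dotReflect_eq hkl hm, LinearMap.add_apply,
    smul_comm]

end

end SlVerma

end

open SlVerma
theorem theorem4p3 (n : ℕ) (lam : Weight n) (k l : Fin (n + 1)) (hkl : k < l) (m : ℕ)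
    (hm : form (lam + rho n) (e k - e l) = (m : ℂ)) :
    (weightExpo k l m).Finite ∧
    IsSingular (∑ᶠ a ∈ weightExpo k l m, coeff lam k l m a • mono a • vac lam) ∧
    IsWeightVector (dotReflect (e k - e l) lam)
      (∑ᶠ a ∈ weightExpo k l m, coeff lam k l m a • mono a • vac lam) := by
  have hset : weightExpo k l m = ↑(wtFinset ((m : ℂ) • (e l - e k : Weight n))) :=
    Set.ext fun a => mem_weightExpo.trans mem_wtFinset.symm
  have hv : ∑ᶠ a ∈ weightExpo k l m, coeff lam k l m a • mono a • vac lam =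
      singularVector lam k l m := by
    rw [hset, finsum_mem_coe_finset]
    rfl
  have hw := isWeightVector_singularVector hkl hm
  rw [hv]
  exact ⟨hset ▸ Finset.finite_toSet _, ⟨⟨_, hw⟩, fun x hx =>
    nilradical_smul_eq_zero (raise_smul_singularVector hkl hm) hx⟩, hw⟩
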